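/- **Setting.** Let $D$ be a connected (non-empty) unoriented link diagram in the plane, with $c=n+1\ge 0$ ordered crossings. A state $s$ labels each crossing $A$ or $B$; smoothing the crossings accordingly gives a system $sD$ of $|sD|$ circles, with one chord at each crossing (the $A$-smoothing joins the two regions swept by the over-strand when it is turned counterclockwise, the $B$-smoothing the other two). Put $\sigma(s)=|s^{-1}(A)|-|s^{-1}(B)|$. An enhanced state is a state $s$ with a sign $\varepsilon_a=\pm1$ on each circle $a$ of $sD$; put $\tau(s)=\sum_a\varepsilon_a$, $i(s)=\sigma(s)$ and $j(s)=\sigma(s)+2\tau(s)$. Let $C_{i,j}(D)$ be the free abelian group on the enhanced states with $i(s)=i$ and $j(s)=j$, and let $\partial_i:C_{i,j}(D)\to C_{i-2,j}(D)$, $\partial_i(s)=\sum_t(s:t)\,t$. Here $(s:t)=0$ unless $t$ is adjacent to $s$, i.e. $i(t)=i(s)-2$, $j(t)=j(s)$, the labels of $s$ and $t$ differ at exactly one crossing $x$, where $s$ has label $A$ and $t$ has label $B$, and the signs of $s$ and $t$ agree on the circles common to $sD$ and $tD$ (those not touching $x$); in that case $(s:t)=(-1)^k$ with $k$ the number of $B$-labelled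 crossings of $s$ after $x$. Let $j_{\max}(D)$ be the maximum of $j(s)$ over all enhanced states and $j_{\rm almax}(D)=j_{\max}(D)-4$; the almost-extreme Khovanov complex of $D$ is $\{C_{i,j_{\rm almax}(D)}(D),\partial_i\}_i$. Let $s_A$ be the state with all labels $A$ and let $G=G_A(D)$ be the graph whose vertices $T_0,\dots,T_m$ are the circles of $s_AD$ and whose edges $v_0<\dots<v_n$ are the crossings of $D$, the edge of a crossing joining the circles at the two ends of its chord. $D$ is $A$-adequate if $G$ has no loops. A partial presimplicial set consists of sets $X_k$ $(k\ge0)$ and partial maps $d_i:X_k\to X_{k-1}$ $(0\le i\le k,\ k\ge1)$ such that, for $i<j$, the partial maps $d_id_j$ and $d_{j-1}d_i$ have the same domain and agree on it. It is proper if some face $d_i(a)$ is undefined. Its geometric realization is obtained from $\bigsqcup_k X_k\times\Delta^k$, together with an additional vertex $b$ if it is proper, by identifying $(a,d^it)$ with $(d_ia,t)$ if $d_ia$ is defined and with $b$ otherwise, where $d^i:\Delta^{k-1}\to\Delta^k$ is the inclusion of the $i$-th facet. It is a CW complex whose cells are the elements of the sets $X_k$ and, in the proper case, the $0$-cell $b$.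 For $A$-adequate $D$, let $\mathcal X_D=(X_k,d_i)$ be as follows. $X_n=\{T_0,\dots,T_m\}$ (if $n\geq 0$); for $0\le k<n$, $X_k$ is the set of tuples $(w_0,\dots,w_k)$ of edges of $G$ with $w_0<\dots<w_k$ such that the $n-k$ remaining edges all join the same pair of vertices; $X_k=\emptyset$ for $k>n$. For $n\ge1$, $d_i(T_j)=(v_0,\dots,\hat v_i,\dots,v_n)$ if $v_i$ is adjacent to $T_j$, and $d_i(T_j)$ is undefined otherwise. For $0<k<n$, $d_i(w_0,\dots,w_k)=(w_0,\dots,\hat w_i,\dots,w_k)$ if $w_i$ joins the same pair of vertices as the edges in $E(G)\setminus\{w_0,\dots,w_k\}$, and it is undefined otherwise. **Theorem.** Let $D$ be a connected $A$-adequate link diagram. Then the almost-extreme Khovanov complex of $D$ is a chain complex, and it is chain homotopy equivalent to the reduced (augmented) cellular chain complex $\cdots\to C_1\to C_0\to\mathbb Z$ of $|\mathcal X_D|$, where $C_{i,j_{\rm almax}(D)}(D)$ with $i=2m-c$, $m \geq 0$, corresponds to the cellular chains of dimension $m-1$ (the last $\mathbb Z$ having dimension $-1$; for $c=0$, $|\mathcal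 X_D|=\emptyset$ and the cellular complex is $\mathbb Z$ in dimension $-1$). -/

import Mathlib

open CategoryTheory

/-! ### Partial presimplicial sets and their geometric realization -/

/-- A partial presimplicial set: sets `X₀, X₁, …` and partial maps
`dᵢ : Xₙ₊₁ → Xₙ`, `0 ≤ i ≤ n + 1`, such that for `i < j` either `dᵢ dⱼ` and `dⱼ₋₁ dᵢ` are both
defined and agree, or both are undefined (this is the equality of elements of `Part (Xₙ)` below,
in which `j` has been replaced by `j + 1`). -/
structure PartialPresimplicialSet where
  obj : ℕ → Type
  d : (n : ℕ) → Fin (n + 2) → (obj (n + 1) →. obj n)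
  comm : ∀ (n : ℕ) (i j : Fin (n + 2)), i ≤ j → ∀ x : obj (n + 2),
    (d (n + 1) j.succ x).bind (d n i) = (d (n + 1) i.castSucc x).bind (d n j)

/-- The model simplex `Δⁿ = {x ∈ ℝⁿ⁺¹ | ∑ xᵢ = 1, xᵢ ≥ 0}`. -/
abbrev ModelSimplex (n : ℕ) : Type := stdSimplex ℝ (Fin (n + 1))

/-- The embedding `dⁱ(x₀, …, xₙ) = (x₀, …, xᵢ₋₁, 0, xᵢ, …, xₙ)` of `Δⁿ` onto the `i`-th facet of
`Δⁿ⁺¹`. -/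
def coface {n : ℕ} (i : Fin (n + 2)) : C(ModelSimplex n, ModelSimplex (n + 1)) where
  toFun x := ⟨i.insertNth (α := fun _ => ℝ) 0 x.1, by
    refine ⟨fun k => ?_, ?_⟩
    · induction k using Fin.succAboveCases i with
      | x => simp
      | p k => simpa using x.2.1 k
    · rw [Fin.sum_univ_succAbove _ i]
      simpa using x.2.2⟩
  continuous_toFun := by
    refine Continuous.subtype_mk ?_ _
    refine continuous_pi fun k => ?_
    induction k using Fin.succAboveCases i with
    | x => simpa using continuous_const
    | p k =>
      simp only [Fin.insertNth_apply_succAbove]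
      exact (continuous_apply k).comp continuous_subtype_val

@[simp] theorem coface_same {n : ℕ} (i : Fin (n + 2)) (x : ModelSimplex n) :
    (coface i x) i = 0 :=
  Fin.insertNth_apply_same (α := fun _ => ℝ) i 0 x.1

@[simp] theorem coface_succAbove {n : ℕ} (i : Fin (n + 2)) (x : ModelSimplex n)
    (k : Fin (n + 1)) : (coface i x) (i.succAbove k) = x k :=
  Fin.insertNth_apply_succAbove (α := fun _ => ℝ) i 0 x.1 k

theorem coface_injective {n : ℕ} (i : Fin (n + 2)) :
    Function.Injective (coface (n := n) i) := by
  intro x y h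
  ext k
  have := congrArg (fun z : ModelSimplex (n + 1) => z (i.succAbove k)) h
  simpa using this

theorem exists_coface_eq {n : ℕ} (i : Fin (n + 2)) (y : ModelSimplex (n + 1)) (h : y i = 0) :
    ∃ x : ModelSimplex n, coface i x = y := by
  refine ⟨⟨fun k => y (i.succAbove k), fun k => y.2.1 _, ?_⟩, ?_⟩
  · have h1 : ∑ k, y k = 1 := y.2.2
    rw [Fin.sum_univ_succAbove _ i, h, zero_add] at h1
    exact h1
  · ext k
    induction k using Fin.succAboveCases i with
    | x => rw [coface_same, h]
    | p k => rw [coface_succAbove]; rfl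

theorem castSucc_lt_succ_of_le {m : ℕ} {i j : Fin m} (h : i ≤ j) : i.castSucc < j.succ :=
  Nat.lt_succ_of_le h

theorem le_of_castSucc_lt_succ {m : ℕ} {i j : Fin m} (h : i.castSucc < j.succ) : i ≤ j :=
  Nat.le_of_lt_succ h

theorem castSucc_le_castSucc_of_le {m : ℕ} {i j : Fin m} (h : i ≤ j) :
    i.castSucc ≤ j.castSucc := h

theorem coface_coface {n : ℕ} (i j : Fin (n + 2)) (hij : i ≤ j) (x : ModelSimplex n) :
    coface j.succ (coface i x) = coface i.castSucc (coface j x) := by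
  have key : ∀ k : Fin (n + 1),
      j.succ.succAbove (i.succAbove k) = i.castSucc.succAbove (j.succAbove k) := by
    intro k
    ext
    simp only [Fin.succAbove, Fin.lt_def, Fin.le_def] at *
    grind [Fin.val_castSucc]
  have h1 : j.succ.succAbove i = i.castSucc := by
    rw [Fin.succAbove_of_castSucc_lt]
    exact castSucc_lt_succ_of_le hij
  have h2 : i.castSucc.succAbove j = j.succ := by
    rw [Fin.succAbove_of_le_castSucc]
    exact castSucc_le_castSucc_of_le hij
  ext k
  induction k using Fin.succAboveCases j.succ with
  | x =>
    rw [coface_same]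
    conv_rhs => rw [← h2]
    simp
  | p k =>
    induction k using Fin.succAboveCases i with
    | x => rw [coface_succAbove, coface_same, h1, coface_same]
    | p k => rw [coface_succAbove, coface_succAbove, key, coface_succAbove, coface_succAbove]

/-- The barycentre of the model simplex. -/
noncomputable def barycentre (n : ℕ) : ModelSimplex n :=
  ⟨fun _ => ((n : ℝ) + 1)⁻¹, fun _ => by positivity, by
    simp only [Finset.sum_const, Finset.card_univ, Fintype.card_fin, nsmul_eq_mul, Nat.cast_add,
      Nat.cast_one]
    field_simp⟩

theorem barycentre_ne_zero (n : ℕ) (i : Fin (n + 1)) : (barycentre n) i ≠ 0 := by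
  have : (0 : ℝ) < ((n : ℝ) + 1)⁻¹ := by positivity
  exact this.ne'

namespace PartialPresimplicialSet

variable (X : PartialPresimplicialSet)

/-- `X` is proper if it is not a presimplicial set, i.e. if some face is undefined. -/
def IsProper : Prop := ∃ (n : ℕ) (i : Fin (n + 2)) (a : X.obj (n + 1)), ¬ (X.d n i a).Dom

/-- The base vertex `b`; it is present exactly when `X` is proper. -/
abbrev Base : Type := {_u : Unit // X.IsProper}

/-- The disjoint union of `b` (if `X` is proper) and of one copy of `Δⁿ` for each `a ∈ Xₙ`. -/
abbrev PrePoint : Type := X.Base ⊕ (Σ a : (Σ n, X.obj n), ModelSimplex a.1)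

variable {X}

/-- The point `t` of the copy of `Δⁿ` named `a`. -/
abbrev PrePoint.mk {n : ℕ} (a : X.obj n) (t : ModelSimplex n) : X.PrePoint := Sum.inr ⟨⟨n, a⟩, t⟩

variable (X)

/-- The identifications `(a, dⁱ t) ∼ (dᵢ a, t)` if `dᵢ a` is defined, and `(a, dⁱ t) ∼ b`
otherwise. -/
inductive Glue : X.PrePoint → X.PrePoint → Prop
  | face {n : ℕ} (a : X.obj (n + 1)) (i : Fin (n + 2)) (t : ModelSimplex n)
      (h : (X.d n i a).Dom) :
      Glue (PrePoint.mk a (coface i t)) (PrePoint.mk ((X.d n i a).get h) t)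
  | collapse {n : ℕ} (a : X.obj (n + 1)) (i : Fin (n + 2)) (t : ModelSimplex n)
      (h : ¬ (X.d n i a).Dom) :
      Glue (PrePoint.mk a (coface i t)) (Sum.inl ⟨(), ⟨n, i, a, h⟩⟩)

/-- The geometric realization `|X|`, pointed by `b` when `X` is proper, with the quotient
topology. -/
def Realization : Type := Quot X.Glue

instance : TopologicalSpace X.Realization := inferInstanceAs (TopologicalSpace (Quot X.Glue))

/-- The cells of `|X|`: its `n`-cells are the elements of `Xₙ` and, for `n = 0` and `X` proper,
the vertex `b`. -/
def Cell : ℕ → Type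
  | 0 => X.Base ⊕ X.obj 0
  | n + 1 => X.obj (n + 1)

variable {X}

/-- The characteristic map `Δⁿ → |X|` given by an element of `Xₙ`. -/
def simplexMap {n : ℕ} (a : X.obj n) : C(ModelSimplex n, X.Realization) where
  toFun t := Quot.mk _ (PrePoint.mk a t)
  continuous_toFun := by
    refine continuous_quot_mk.comp ?_
    exact continuous_inr.comp
      (continuous_sigmaMk (σ := fun a : (Σ n, X.obj n) => ModelSimplex a.1) (i := ⟨n, a⟩))

/-- The constant map from `Δⁿ` to the vertex `b`. -/
def baseMap (n : ℕ) (b : X.Base) : C(ModelSimplex n, X.Realization) :=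
  ContinuousMap.const _ (Quot.mk _ (Sum.inl b))

/-- The characteristic map `Δⁿ → |X|` of an `n`-cell. -/
def charMap : {n : ℕ} → X.Cell n → C(ModelSimplex n, X.Realization)
  | 0, Sum.inl b => baseMap 0 b
  | 0, Sum.inr a => simplexMap a
  | _ + 1, a => simplexMap a

/-- The attaching map of a simplex restricted to a facet whose face is defined is the
characteristic map of that face. -/
theorem simplexMap_comp_coface_of_dom {n : ℕ} (a : X.obj (n + 1)) (i : Fin (n + 2))
    (h : (X.d n i a).Dom) :
    (simplexMap a).comp (coface i) = simplexMap ((X.d n i a).get h) := by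
  ext t
  exact Quot.sound (Glue.face a i t h)

/-- The attaching map of a simplex restricted to a facet whose face is undefined is constant. -/
theorem simplexMap_comp_coface_of_not_dom {n : ℕ} (a : X.obj (n + 1)) (i : Fin (n + 2))
    (h : ¬ (X.d n i a).Dom) :
    (simplexMap a).comp (coface i) = baseMap n ⟨(), ⟨n, i, a, h⟩⟩ := by
  ext t
  exact Quot.sound (Glue.collapse a i t h)

theorem Glue.inv {p q : X.PrePoint} (h : X.Glue p q) :
    ∃ (n : ℕ) (a : X.obj (n + 1)) (i : Fin (n + 2)) (t : ModelSimplex n),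
      p = PrePoint.mk a (coface i t) ∧
        ((∃ h : (X.d n i a).Dom, q = PrePoint.mk ((X.d n i a).get h) t) ∨
          (¬ (X.d n i a).Dom ∧ ∃ b, q = Sum.inl b)) := by
  cases h with
  | face a i t h => exact ⟨_, a, i, t, rfl, Or.inl ⟨h, rfl⟩⟩
  | collapse a i t h => exact ⟨_, a, i, t, rfl, Or.inr ⟨h, _, rfl⟩⟩

theorem PrePoint.mk_inj {n m : ℕ} {a : X.obj n} {a' : X.obj m} {t : ModelSimplex n}
    {t' : ModelSimplex m} (h : PrePoint.mk a t = PrePoint.mk a' t') :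
    ∃ e : n = m, e ▸ a = a' ∧ e ▸ t = t' := by
  simp only [PrePoint.mk, Sum.inr.injEq, Sigma.mk.injEq] at h
  obtain ⟨⟨rfl, h1⟩, h2⟩ := h
  exact ⟨rfl, eq_of_heq h1, eq_of_heq h2⟩

/-- Two different faces of the same point are identified with a common point. -/
theorem glue_diamond_aux {n : ℕ} (a : X.obj (n + 1)) (i i' : Fin (n + 2)) (hlt : i < i')
    (t t' : ModelSimplex n) (ht : coface i t = coface i' t') (q q' : X.PrePoint)
    (hq : (∃ h : (X.d n i a).Dom, q = PrePoint.mk ((X.d n i a).get h) t) ∨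
          (¬ (X.d n i a).Dom ∧ ∃ b, q = Sum.inl b))
    (hq' : (∃ h : (X.d n i' a).Dom, q' = PrePoint.mk ((X.d n i' a).get h) t') ∨
          (¬ (X.d n i' a).Dom ∧ ∃ b, q' = Sum.inl b)) :
    ∃ r, Relation.ReflGen X.Glue q r ∧ Relation.ReflGen X.Glue q' r := by
  obtain ⟨k, rfl⟩ : ∃ k, i = Fin.castSucc k := ⟨i.castPred (Fin.ne_last_of_lt hlt), by simp⟩
  obtain ⟨l, rfl⟩ : ∃ l, i' = Fin.succ l := ⟨i'.pred (Fin.ne_zero_of_lt hlt), by simp⟩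
  have hkl : k ≤ l := le_of_castSucc_lt_succ hlt
  -- the point has two vanishing coordinates, so the dimension is at least two
  cases n with
  | zero =>
    exfalso
    have hk : k = 0 := Fin.fin_one_eq_zero k
    have hl : l = 0 := Fin.fin_one_eq_zero l
    subst hk hl
    have e0 : (coface (Fin.castSucc 0) t) 0 = 0 := coface_same (Fin.castSucc 0) t
    have e1 : (coface (Fin.succ 0) t') 1 = 0 := coface_same (Fin.succ 0) t'
    rw [← ht] at e1
    have : ∑ k, (coface (Fin.castSucc 0) t) k = 1 := (coface (Fin.castSucc 0) t).2.2
    rw [Fin.sum_univ_two, e0, e1] at this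
    norm_num at this
  | succ m =>
    have hz : t l = 0 := by
      have h1 : (coface k.castSucc t) l.succ = 0 := by rw [ht]; exact coface_same _ _
      have h2 : k.castSucc.succAbove l = l.succ := by
        rw [Fin.succAbove_of_le_castSucc]
        exact castSucc_le_castSucc_of_le hkl
      rw [← h2, coface_succAbove] at h1
      exact h1
    obtain ⟨u, rfl⟩ := exists_coface_eq l t hz
    rw [← coface_coface k l hkl] at ht
    have ht' := coface_injective _ ht
    subst ht'
    have hc := X.comm m k l hkl a
    rcases hq with ⟨h, rfl⟩ | ⟨h, b, rfl⟩ <;> rcases hq' with ⟨h', rfl⟩ | ⟨h', b', rfl⟩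
    · have e1 : (X.d (m + 1) k.castSucc a).bind (X.d m l) =
          X.d m l ((X.d (m + 1) k.castSucc a).get h) := Part.bind_of_mem (Part.get_mem h) _
      have e2 : (X.d (m + 1) l.succ a).bind (X.d m k) =
          X.d m k ((X.d (m + 1) l.succ a).get h') := Part.bind_of_mem (Part.get_mem h') _
      rw [e1, e2] at hc
      by_cases hd : (X.d m l ((X.d (m + 1) k.castSucc a).get h)).Dom
      · have hd' : (X.d m k ((X.d (m + 1) l.succ a).get h')).Dom := by rw [hc]; exact hd
        refine ⟨_, .single (Glue.face _ l u hd), ?_⟩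
        have := Glue.face _ k u hd'
        have hg : (X.d m k ((X.d (m + 1) l.succ a).get h')).get hd' =
            (X.d m l ((X.d (m + 1) k.castSucc a).get h)).get hd := by
          congr 1
        rw [hg] at this
        exact .single this
      · have hd' : ¬ (X.d m k ((X.d (m + 1) l.succ a).get h')).Dom := by rw [hc]; exact hd
        exact ⟨_, .single (Glue.collapse _ l u hd), .single (Glue.collapse _ k u hd')⟩
    · have e1 : (X.d (m + 1) k.castSucc a).bind (X.d m l) =
          X.d m l ((X.d (m + 1) k.castSucc a).get h) := Part.bind_of_mem (Part.get_mem h) _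
      have hd : ¬ (X.d m l ((X.d (m + 1) k.castSucc a).get h)).Dom := by
        rw [← e1, ← hc]
        exact fun hh => h' hh.1
      exact ⟨_, .single (Glue.collapse _ l u hd), .refl⟩
    · have e2 : (X.d (m + 1) l.succ a).bind (X.d m k) =
          X.d m k ((X.d (m + 1) l.succ a).get h') := Part.bind_of_mem (Part.get_mem h') _
      have hd : ¬ (X.d m k ((X.d (m + 1) l.succ a).get h')).Dom := by
        rw [← e2, hc]
        exact fun hh => h hh.1
      exact ⟨_, .refl, .single (Glue.collapse _ k u hd)⟩
    · rw [Subsingleton.elim b b']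
      exact ⟨_, .refl, .refl⟩

theorem glue_diamond {p q q' : X.PrePoint} (h : X.Glue p q) (h' : X.Glue p q') :
    ∃ r, Relation.ReflGen X.Glue q r ∧ Relation.ReflGen X.Glue q' r := by
  obtain ⟨n, a, i, t, rfl, hq⟩ := h.inv
  obtain ⟨n', a', i', t', hp, hq'⟩ := h'.inv
  obtain ⟨e, ha, ht⟩ := PrePoint.mk_inj hp
  obtain rfl : n = n' := by omega
  dsimp only at ha ht
  subst ha
  rcases lt_trichotomy i i' with hlt | rfl | hlt
  · exact glue_diamond_aux a i i' hlt t t' ht q q' hq hq'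
  · have := coface_injective _ ht
    subst this
    have : q = q' := by
      rcases hq with ⟨hd, rfl⟩ | ⟨hd, b, rfl⟩ <;> rcases hq' with ⟨hd', rfl⟩ | ⟨hd', b', rfl⟩
      · rfl
      · exact absurd hd hd'
      · exact absurd hd' hd
      · rw [Subsingleton.elim b b']
    subst this
    exact ⟨q, .refl, .refl⟩
  · obtain ⟨r, h1, h2⟩ := glue_diamond_aux a i' i hlt t' t ht.symm q' q hq' hq
    exact ⟨r, h2, h1⟩

/-- Points in the interior of a cell are identified with no other such points. -/
theorem eq_of_quot_eq {p q : X.PrePoint} (hp : ∀ r, ¬ X.Glue p r) (hq : ∀ r, ¬ X.Glue q r)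
    (h : Quot.mk X.Glue p = Quot.mk X.Glue q) : p = q := by
  have hj : ∀ p q, Relation.EqvGen X.Glue p q →
      Relation.Join (Relation.ReflTransGen X.Glue) p q := by
    have heq : Equivalence (Relation.Join (Relation.ReflTransGen X.Glue)) :=
      Relation.equivalence_join_reflTransGen fun a b c hab hac => by
        obtain ⟨r, h1, h2⟩ := glue_diamond hab hac
        exact ⟨r, h1, Relation.ReflGen.to_reflTransGen h2⟩
    intro p q hpq
    induction hpq with
    | rel x y hxy => exact ⟨y, .single hxy, .refl⟩
    | refl x => exact heq.refl x
    | symm x y _ ih => exact heq.symm ih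
    | trans x y z _ _ ih1 ih2 => exact heq.trans ih1 ih2
  obtain ⟨r, h1, h2⟩ := hj p q (Quot.eqvGen_exact h)
  rcases h1.cases_head with rfl | ⟨s, hs, -⟩
  · rcases h2.cases_head with rfl | ⟨s, hs, -⟩
    · rfl
    · exact absurd hs (hq s)
  · exact absurd hs (hp s)

theorem not_glue_barycentre {n : ℕ} (a : X.obj n) (r : X.PrePoint) :
    ¬ X.Glue (PrePoint.mk a (barycentre n)) r := by
  intro h
  obtain ⟨m, a', i, t, hp, -⟩ := h.inv
  obtain ⟨e, -, ht⟩ := PrePoint.mk_inj hp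
  subst e
  dsimp only at ht
  apply barycentre_ne_zero (m + 1) i
  rw [ht]
  exact coface_same _ _

theorem not_glue_base (b : X.Base) (r : X.PrePoint) : ¬ X.Glue (Sum.inl b) r := by
  intro h
  obtain ⟨m, a', i, t, hp, -⟩ := h.inv
  simp at hp

theorem simplexMap_injective {n : ℕ} :
    Function.Injective (simplexMap : X.obj n → C(ModelSimplex n, X.Realization)) := by
  intro a a' h
  have := eq_of_quot_eq (not_glue_barycentre a) (not_glue_barycentre a')
    (DFunLike.congr_fun h (barycentre n))
  obtain ⟨e, h1, -⟩ := PrePoint.mk_inj this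
  exact h1

theorem simplexMap_ne_baseMap {n : ℕ} (a : X.obj n) (b : X.Base) :
    simplexMap a ≠ baseMap n b := by
  intro h
  have := eq_of_quot_eq (not_glue_barycentre a) (not_glue_base b)
    (DFunLike.congr_fun h (barycentre n))
  simp at this

/-- Different cells have different characteristic maps. -/
theorem charMap_injective {n : ℕ} :
    Function.Injective (charMap : X.Cell n → C(ModelSimplex n, X.Realization)) := by
  cases n with
  | zero =>
    rintro (b | a) (b' | a') h
    · rw [Subsingleton.elim b b']
    · exact absurd h.symm (simplexMap_ne_baseMap a' b)
    · exact absurd h (simplexMap_ne_baseMap a b')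
    · rw [simplexMap_injective h]
  | succ n => exact simplexMap_injective

/-! ### The cellular chain complex of the realization -/

open Classical in
/-- The chain carried by a map `f : Δⁿ → |X|`: the cell `e` if `f` is the characteristic map of
an `n`-cell `e` (which is then unique), and `0` otherwise. -/
noncomputable def cellChain {n : ℕ} (f : C(ModelSimplex n, X.Realization)) : X.Cell n →₀ ℤ :=
  if h : ∃ e : X.Cell n, charMap e = f then Finsupp.single h.choose 1 else 0

theorem cellChain_charMap {n : ℕ} (e : X.Cell n) :
    cellChain (charMap e) = Finsupp.single e 1 := by
  have h : ∃ e' : X.Cell n, charMap e' = charMap e := ⟨e, rfl⟩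
  rw [cellChain, dif_pos h, charMap_injective h.choose_spec]

theorem cellChain_baseMap_succ (n : ℕ) (b : X.Base) :
    cellChain (baseMap (n + 1) b) = 0 := by
  rw [cellChain, dif_neg]
  rintro ⟨e, he⟩
  exact simplexMap_ne_baseMap (X := X) (n := n + 1) e b he

variable (X)

/-- The cellular boundary map `C_{n+1}(|X|) → C_n(|X|)`. The boundary sphere of `Δⁿ⁺¹` is the
union of its facets, the `i`-th of which has orientation sign `(-1)ⁱ`, and the attaching map of
an `(n+1)`-cell restricted to a facet is either the characteristic map of an `n`-cell or a map
constant at `b` (see `simplexMap_comp_coface_of_dom`, `simplexMap_comp_coface_of_not_dom`).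
So the degree with which an `(n+1)`-cell `e` is attached along an `n`-cell `e'` is the sum of the
signs `(-1)ⁱ` of the facets on which the attaching map of `e` is the characteristic map of `e'`. -/
noncomputable def cellularD (n : ℕ) : (X.Cell (n + 1) →₀ ℤ) →ₗ[ℤ] (X.Cell n →₀ ℤ) :=
  Finsupp.linearCombination ℤ fun e : X.Cell (n + 1) =>
    ∑ i : Fin (n + 2), (-1 : ℤ) ^ (i : ℕ) • cellChain ((charMap e).comp (coface i))

variable {X}

theorem cellularD_single {n : ℕ} (e : X.Cell (n + 1)) :
    X.cellularD n (Finsupp.single e 1) =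
      ∑ i : Fin (n + 2), (-1 : ℤ) ^ (i : ℕ) • cellChain ((charMap e).comp (coface i)) := by
  simp [cellularD]

theorem cellularD_cellChain {n : ℕ} (a : X.obj (n + 2)) (i : Fin (n + 3)) :
    X.cellularD n (cellChain ((simplexMap a).comp (coface i))) =
      ∑ j : Fin (n + 2),
        (-1 : ℤ) ^ (j : ℕ) • cellChain (((simplexMap a).comp (coface i)).comp (coface j)) := by
  by_cases h : (X.d (n + 1) i a).Dom
  · rw [simplexMap_comp_coface_of_dom a i h]
    have h1 := cellularD_single (X := X) (n := n) ((X.d (n + 1) i a).get h)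
    have h2 := cellChain_charMap (X := X) (n := n + 1) ((X.d (n + 1) i a).get h)
    exact (congrArg (X.cellularD n) h2).trans h1
  · rw [simplexMap_comp_coface_of_not_dom a i h, cellChain_baseMap_succ, map_zero]
    symm
    have hb : ∀ j : Fin (n + 2), (baseMap (n + 1) ⟨(), ⟨n + 1, i, a, h⟩⟩ :
        C(ModelSimplex (n + 1), X.Realization)).comp (coface j) =
          baseMap n ⟨(), ⟨n + 1, i, a, h⟩⟩ := fun j => rfl
    simp only [hb]
    cases n with
    | zero => simp [Fin.sum_univ_two]
    | succ n => simp [cellChain_baseMap_succ]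

theorem alternating_sum_eq_zero {M : Type*} [AddCommGroup M] (n : ℕ)
    (g : Fin (n + 3) → Fin (n + 2) → M)
    (hg : ∀ i j : Fin (n + 2), i ≤ j → g j.succ i = g i.castSucc j) :
    ∑ i : Fin (n + 3), (-1 : ℤ) ^ (i : ℕ) • ∑ j : Fin (n + 2), (-1 : ℤ) ^ (j : ℕ) • g i j = 0 := by
  simp only [Finset.smul_sum, smul_smul]
  rw [← Finset.sum_product']
  refine Finset.sum_involution
    (fun p _ => if h : p.2.castSucc < p.1 then
        (p.2.castSucc, p.1.pred (Fin.ne_zero_of_lt h))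
      else (p.2.succ, p.1.castPred (Fin.ne_last_of_lt (b := p.2.succ)
        (lt_of_le_of_lt (not_lt.mp h) (Fin.castSucc_lt_succ))))) ?_ ?_ ?_ ?_
  · rintro ⟨i, j⟩ -
    dsimp only
    split_ifs with h
    · obtain ⟨k, rfl⟩ : ∃ k, i = Fin.succ k := ⟨i.pred (Fin.ne_zero_of_lt h), by simp⟩
      have hjk : j ≤ k := le_of_castSucc_lt_succ h
      simp only [Fin.pred_succ, hg j k hjk, Fin.val_succ, Fin.val_castSucc, ← add_smul]
      convert zero_smul ℤ _ using 2
      ring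
    · have h' : i ≠ Fin.last _ := Fin.ne_last_of_lt (b := j.succ)
        (lt_of_le_of_lt (not_lt.mp h) (Fin.castSucc_lt_succ))
      obtain ⟨k, rfl⟩ : ∃ k, i = Fin.castSucc k := ⟨i.castPred h', by simp⟩
      have hkj : k ≤ j := not_lt.mp h
      simp only [Fin.castPred_castSucc, hg k j hkj, Fin.val_succ, Fin.val_castSucc, ← add_smul]
      convert zero_smul ℤ _ using 2
      ring
  · rintro ⟨i, j⟩ - -
    dsimp only
    split_ifs with h
    · intro he
      have := congrArg Prod.fst he
      dsimp only at this
      exact absurd this h.ne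
    · intro he
      have := congrArg Prod.fst he
      dsimp only at this
      rw [← this] at h
      exact h Fin.castSucc_lt_succ
  · intro a ha
    exact Finset.mem_product.mpr ⟨Finset.mem_univ _, Finset.mem_univ _⟩
  · rintro ⟨i, j⟩ -
    dsimp only
    by_cases h : j.castSucc < i
    · simp only [h, dite_true]
      have h2 : ¬ (i.pred (Fin.ne_zero_of_lt h)).castSucc < j.castSucc := by
        simp only [Fin.lt_def, Fin.val_castSucc, Fin.val_pred] at h ⊢
        omega
      simp [h2]
    · simp only [h, dite_false]
      have h' : i ≠ Fin.last _ := Fin.ne_last_of_lt (b := j.succ)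
        (lt_of_le_of_lt (not_lt.mp h) (Fin.castSucc_lt_succ))
      have h2 : (i.castPred h').castSucc < j.succ := by
        rw [Fin.castSucc_castPred]
        exact lt_of_le_of_lt (not_lt.mp h) Fin.castSucc_lt_succ
      simp only [h2, dite_true]
      simp

theorem cellularD_comp (n : ℕ) : X.cellularD n ∘ₗ X.cellularD (n + 1) = 0 := by
  refine Finsupp.lhom_ext' fun e => LinearMap.ext_ring ?_
  simp only [LinearMap.comp_apply, Finsupp.lsingle_apply, LinearMap.zero_apply]
  rw [cellularD_single, map_sum]
  simp only [map_smul]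
  have : ∀ i : Fin (n + 3), X.cellularD n (cellChain ((charMap e).comp (coface i))) =
      ∑ j : Fin (n + 2),
        (-1 : ℤ) ^ (j : ℕ) • cellChain (((charMap e).comp (coface i)).comp (coface j)) :=
    fun i => cellularD_cellChain (X := X) e i
  simp only [this]
  refine alternating_sum_eq_zero n
    (fun i j => cellChain (((charMap e).comp (coface i)).comp (coface j))) ?_
  intro i j hij
  congr 1
  ext x
  exact congrArg (charMap e) (coface_coface i j hij x)

variable (X)

/-- The cellular chain complex of `|X|`: it is free on the `n`-cells in degree `n`. -/
noncomputable def cellularComplex : ChainComplex (ModuleCat.{0} ℤ) ℕ :=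
  ChainComplex.of (fun n => ModuleCat.of ℤ (X.Cell n →₀ ℤ)) (fun n => ModuleCat.ofHom (X.cellularD n))
    (fun n => by rw [← ModuleCat.ofHom_comp, cellularD_comp]; rfl)

theorem cellularComplex_d (n : ℕ) :
    X.cellularComplex.d (n + 1) n = ModuleCat.ofHom (X.cellularD n) :=
  ChainComplex.of_d (fun n => ModuleCat.of ℤ (X.Cell n →₀ ℤ))
    (fun n => ModuleCat.ofHom (X.cellularD n)) n

/-- The augmentation `C₀(|X|) → ℤ`, sending each vertex to `1`. -/
noncomputable def augmentation : (X.Cell 0 →₀ ℤ) →ₗ[ℤ] ℤ :=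
  Finsupp.linearCombination ℤ fun _ => (1 : ℤ)

variable {X}

theorem augmentation_cellularD : X.augmentation ∘ₗ X.cellularD 0 = 0 := by
  refine Finsupp.lhom_ext' fun e => LinearMap.ext_ring ?_
  simp only [LinearMap.comp_apply, Finsupp.lsingle_apply, LinearMap.zero_apply]
  rw [cellularD_single, map_sum]
  have : ∀ i : Fin 2, X.augmentation (cellChain ((charMap e).comp (coface i))) = 1 := by
    intro i
    obtain ⟨v, hv⟩ : ∃ v : X.Cell 0, (charMap e).comp (coface i) = charMap v := by
      by_cases h : (X.d 0 i e).Dom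
      · exact ⟨Sum.inr ((X.d 0 i e).get h), simplexMap_comp_coface_of_dom e i h⟩
      · exact ⟨Sum.inl ⟨(), ⟨0, i, e, h⟩⟩, simplexMap_comp_coface_of_not_dom e i h⟩
    rw [hv, cellChain_charMap]
    simp [augmentation]
  simp only [map_smul, this]
  simp [Fin.sum_univ_two]

variable (X)

/-- The reduced (i.e. augmented) cellular chain complex of `|X|`, shifted so that degree `m`
consists of the chains of dimension `m - 1`: it is
`⋯ → C₁(|X|) → C₀(|X|) → ℤ`, with `C₀(|X|)` in degree `1` and `ℤ` in degree `0`. -/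
noncomputable def reducedCellularComplex : ChainComplex (ModuleCat.{0} ℤ) ℕ :=
  X.cellularComplex.augment (X := ModuleCat.of ℤ ℤ) (ModuleCat.ofHom X.augmentation) (by
    rw [X.cellularComplex_d 0]
    exact (ModuleCat.ofHom_comp _ _).symm.trans
      (congrArg ModuleCat.ofHom augmentation_cellularD))

end PartialPresimplicialSet

/-! ### The partial presimplicial set of a graph with ordered edges -/

namespace GraphPresimplicial

variable {V : Type} {c : ℕ} (ends : Fin c → Sym2 V)

/-- For a graph with vertex set `V` and edges `v₀ < … < v_{c-1}`, the edge `v_x` joining the pair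
`ends x`: the set `X_k`. With `c = n + 1`, it is the vertex set for `k = n`; for `k < n` it is the
set of tuples `w₀ < … < w_k` of edges such that all the other edges join the same pair of
vertices; for `k > n` it is empty. -/
def Obj (k : ℕ) : Type :=
  {_T : V // k + 1 = c} ⊕
    {w : Fin (k + 1) ↪o Fin c // k + 1 < c ∧
      ∀ x y, x ∉ Set.range w → y ∉ Set.range w → ends x = ends y}

/-- The tuple `(w₀, …, ŵᵢ, …, w_{k+1})`. -/
def omit_edge {k : ℕ} (w : Fin (k + 2) ↪o Fin c) (i : Fin (k + 2)) : Fin (k + 1) ↪o Fin c :=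
  (Fin.succAboveOrderEmb i).trans w

theorem eq_of_not_mem_omit_edge {k : ℕ} (w : Fin (k + 2) ↪o Fin c) (i : Fin (k + 2)) {x : Fin c}
    (hx : x ∉ Set.range (omit_edge w i)) : x = w i ∨ x ∉ Set.range w := by
  by_contra! h
  obtain ⟨h1, l, rfl⟩ := h
  have hl : l ≠ i := fun e => h1 (by rw [e])
  obtain ⟨m, rfl⟩ := Fin.exists_succAbove_eq hl
  exact hx ⟨m, rfl⟩

theorem not_mem_omit_edge_of_not_mem {k : ℕ} (w : Fin (k + 2) ↪o Fin c) (i : Fin (k + 2))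
    {x : Fin c} (hx : x ∉ Set.range w) : x ∉ Set.range (omit_edge w i) := by
  rintro ⟨m, rfl⟩
  exact hx ⟨i.succAbove m, rfl⟩

theorem self_not_mem_omit_edge {k : ℕ} (w : Fin (k + 2) ↪o Fin c) (i : Fin (k + 2)) :
    w i ∉ Set.range (omit_edge w i) := by
  rintro ⟨m, hm⟩
  exact Fin.succAbove_ne i m (w.injective hm)

/-- The tuple `(v₀, …, vₙ)` of all edges, `c = k + 1`. -/
def allEdges {k : ℕ} (h : k + 1 = c) : Fin (k + 1) ↪o Fin c := (Fin.castOrderIso h).toOrderEmbedding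

theorem mem_allEdges {k : ℕ} (h : k + 1 = c) (x : Fin c) : x ∈ Set.range (allEdges h) :=
  (Fin.castOrderIso h).surjective x

/-- The face maps. `dᵢ(T) = (v₀, …, v̂ᵢ, …, vₙ)` is defined if the edge `vᵢ` is adjacent to the
vertex `T`, and `dᵢ(w₀, …, w_k) = (w₀, …, ŵᵢ, …, w_k)` is defined if the edge `wᵢ` joins the same
pair of vertices as the edges that are not in the tuple. -/
def face (k : ℕ) (i : Fin (k + 2)) : Obj ends (k + 1) →. Obj ends k
  | Sum.inl ⟨T, hc⟩ =>
    { Dom := T ∈ ends (allEdges hc i)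
      get := fun _ => Sum.inr ⟨omit_edge (allEdges hc) i, by omega, fun x y hx hy => by
        obtain rfl := (eq_of_not_mem_omit_edge _ _ hx).resolve_right (fun h => h (mem_allEdges hc x))
        obtain rfl := (eq_of_not_mem_omit_edge _ _ hy).resolve_right (fun h => h (mem_allEdges hc y))
        rfl⟩ }
  | Sum.inr ⟨w, hw⟩ =>
    { Dom := ∀ y, y ∉ Set.range w → ends (w i) = ends y
      get := fun h => Sum.inr ⟨omit_edge w i, by omega, fun x y hx hy => by
        rcases eq_of_not_mem_omit_edge _ _ hx with rfl | hx <;>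
          rcases eq_of_not_mem_omit_edge _ _ hy with rfl | hy
        · rfl
        · exact h _ hy
        · exact (h _ hx).symm
        · exact hw.2 x y hx hy⟩ }

theorem omit_omit {k : ℕ} (w : Fin (k + 3) ↪o Fin c) (i j : Fin (k + 2)) (hij : i ≤ j) :
    omit_edge (omit_edge w j.succ) i = omit_edge (omit_edge w i.castSucc) j := by
  ext l
  simp only [omit_edge, RelEmbedding.coe_trans, Function.comp_apply, Fin.succAboveOrderEmb_apply]
  congr 2
  ext
  simp only [Fin.succAbove, Fin.lt_def, Fin.le_def] at *
  grind [Fin.val_castSucc]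

theorem omit_apply_left {k : ℕ} (w : Fin (k + 3) ↪o Fin c) (i j : Fin (k + 2)) (hij : i ≤ j) :
    omit_edge w j.succ i = w i.castSucc := by
  change w (j.succ.succAbove i) = _
  rw [Fin.succAbove_of_castSucc_lt]
  exact castSucc_lt_succ_of_le hij

theorem omit_apply_right {k : ℕ} (w : Fin (k + 3) ↪o Fin c) (i j : Fin (k + 2)) (hij : i ≤ j) :
    omit_edge w i.castSucc j = w j.succ := by
  change w (i.castSucc.succAbove j) = _
  rw [Fin.succAbove_of_le_castSucc]
  exact castSucc_le_castSucc_of_le hij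

theorem face_comm (k : ℕ) (i j : Fin (k + 2)) (hij : i ≤ j) (x : Obj ends (k + 2)) :
    (face ends (k + 1) j.succ x).bind (face ends k i) =
      (face ends (k + 1) i.castSucc x).bind (face ends k j) := by
  rcases x with ⟨T, hc⟩ | ⟨w, hw⟩
  · refine Part.ext' ?_ ?_
    · constructor
      · rintro ⟨h1, h2⟩
        have h3 : ends (allEdges hc i.castSucc) = ends (allEdges hc j.succ) := by
          have := h2 _ (self_not_mem_omit_edge (allEdges hc) j.succ)
          rwa [omit_apply_left _ i j hij] at this
        refine ⟨?_, fun y hy => ?_⟩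
        · change T ∈ ends _
          rw [h3]; exact h1
        · obtain rfl := (eq_of_not_mem_omit_edge _ _ hy).resolve_right
            (fun h => h (mem_allEdges hc y))
          rw [omit_apply_right _ i j hij]
          exact h3.symm
      · rintro ⟨h1, h2⟩
        have h3 : ends (allEdges hc j.succ) = ends (allEdges hc i.castSucc) := by
          have := h2 _ (self_not_mem_omit_edge (allEdges hc) i.castSucc)
          rwa [omit_apply_right _ i j hij] at this
        refine ⟨?_, fun y hy => ?_⟩
        · change T ∈ ends _
          rw [h3]; exact h1
        · obtain rfl := (eq_of_not_mem_omit_edge _ _ hy).resolve_right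
            (fun h => h (mem_allEdges hc y))
          rw [omit_apply_left _ i j hij]
          exact h3.symm
    · intro h1 h2
      exact congrArg Sum.inr (Subtype.ext (omit_omit (allEdges hc) i j hij))
  · refine Part.ext' ?_ ?_
    · constructor
      · rintro ⟨h1, h2⟩
        refine ⟨fun y hy => ?_, fun y hy => ?_⟩
        · have := h2 y (not_mem_omit_edge_of_not_mem _ _ hy)
          rwa [omit_apply_left _ i j hij] at this
        · rw [omit_apply_right _ i j hij]
          rcases eq_of_not_mem_omit_edge _ _ hy with rfl | hy
          · have := h2 _ (self_not_mem_omit_edge w j.succ)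
            rw [omit_apply_left _ i j hij] at this
            exact this.symm
          · exact h1 y hy
      · rintro ⟨h1, h2⟩
        refine ⟨fun y hy => ?_, fun y hy => ?_⟩
        · have := h2 y (not_mem_omit_edge_of_not_mem _ _ hy)
          rwa [omit_apply_right _ i j hij] at this
        · rw [omit_apply_left _ i j hij]
          rcases eq_of_not_mem_omit_edge _ _ hy with rfl | hy
          · have := h2 _ (self_not_mem_omit_edge w i.castSucc)
            rw [omit_apply_right _ i j hij] at this
            exact this.symm
          · exact h1 y hy
    · intro h1 h2
      exact congrArg Sum.inr (Subtype.ext (omit_omit w i j hij))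

end GraphPresimplicial

/-- The partial presimplicial set of a graph with vertex set `V` and ordered edges. -/
def graphPresimplicialSet {V : Type} {c : ℕ} (ends : Fin c → Sym2 V) : PartialPresimplicialSet where
  obj := GraphPresimplicial.Obj ends
  d := GraphPresimplicial.face ends
  comm := GraphPresimplicial.face_comm ends

/-! ### Link diagrams -/

/-- The combinatorial data of an unoriented link diagram on a closed oriented surface: crossings
numbered `0, …, c - 1`; at the crossing `x` four half-edges `(x, 0), (x, 1), (x, 2), (x, 3)` in
counterclockwise order, of which `(x, 0)` and `(x, 2)` belong to the under-strand and `(x, 1)` and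
`(x, 3)` to the over-strand; a pairing `edge` of the half-edges, whose pairs are the edges of the
diagram; and a number of crossingless components. -/
structure DiagramData where
  numCrossings : ℕ
  edge : Fin numCrossings × Fin 4 → Fin numCrossings × Fin 4
  edge_edge : ∀ h, edge (edge h) = h
  edge_ne : ∀ h, edge h ≠ h
  numLoops : ℕ

namespace DiagramData

variable (D : DiagramData)

abbrev Crossing : Type := Fin D.numCrossings

abbrev HalfEdge : Type := D.Crossing × Fin 4

/-- The next half-edge at the same crossing, counterclockwise. -/
def rot (h : D.HalfEdge) : D.HalfEdge := (h.1, h.2 + 1)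

/-- The connected components of the diagram that have a crossing. -/
def Component : Type := Quot fun h h' : D.HalfEdge => h' = D.edge h ∨ h' = D.rot h

/-- The faces of the cellular embedding given by the cyclic orders at the crossings. -/
def Face : Type := Quot fun h h' : D.HalfEdge => h' = D.rot (D.edge h)

/-- Every component is embedded in a sphere: the Euler characteristic `c - 2c + #faces` is twice
the number of the components (that have a crossing). -/
def IsPlanar : Prop := Nat.card D.Face = D.numCrossings + 2 * Nat.card D.Component

end DiagramData

/-- An unoriented link diagram (in the plane or the sphere), with ordered crossings. -/
structure LinkDiagram extends DiagramData where
  planar : toDiagramData.IsPlanar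

/-- The two labels of a crossing. -/
inductive Label
  | A
  | B
  deriving DecidableEq

instance : Fintype Label where
  elems := {.A, .B}
  complete := by rintro (_ | _) <;> simp

namespace LinkDiagram

variable (D : LinkDiagram)

/-- The diagram is connected (as a subset of the plane), and not empty. -/
def IsConnected : Prop := Nat.card D.Component + D.numLoops = 1

/-- A Kauffman state. -/
abbrev State : Type := D.Crossing → Label

/-- How a smoothing joins the four half-edges at a crossing. The `A`-smoothing joins the two
regions that the over-strand sweeps when it is turned counterclockwise, that is, the regions
between the half-edges `1` and `2` and between `3` and `0`; the `B`-smoothing joins the other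
two. -/
def smoothEnd : Label → Fin 4 → Fin 4
  | .A => ![1, 0, 3, 2]
  | .B => ![3, 2, 1, 0]

variable {D}

/-- The half-edge joined to `h` by the smoothing that the state `s` prescribes. -/
def smooth (s : D.State) (h : D.HalfEdge) : D.HalfEdge := (h.1, smoothEnd (s h.1) h.2)

/-- The circles of `sD`: those that run through half-edges, and the crossingless components. -/
def Circle (s : D.State) : Type :=
  (Quot fun h h' : D.HalfEdge => h' = D.edge h ∨ h' = smooth s h) ⊕ Fin D.numLoops

instance (s : D.State) : Finite (Circle s) :=
  inferInstanceAs (Finite ((Quot fun h h' : D.HalfEdge => h' = D.edge h ∨ h' = smooth s h) ⊕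
    Fin D.numLoops))

noncomputable instance (s : D.State) : Fintype (Circle s) := Fintype.ofFinite _

/-- The circle of `sD` through a half-edge. -/
def circleOf (s : D.State) (h : D.HalfEdge) : Circle s := Sum.inl (Quot.mk _ h)

/-- The circle of `sD` given by a crossingless component. -/
def loopCircle (s : D.State) (k : Fin D.numLoops) : Circle s := Sum.inr k

/-- The state graph `G_s(D)`: its vertices are the circles of `sD`, and its edges are the
crossings, the crossing `x` joining the two circles at the ends of the chord of `sD` at `x`. For
both smoothings the half-edges `(x, 0)` and `(x, 2)` lie on the two different arcs at `x`. -/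
def stateGraph (s : D.State) (x : D.Crossing) : Sym2 (Circle s) :=
  s(circleOf s (x, 0), circleOf s (x, 2))

variable (D)

/-- The state that assigns an `A`-label to each crossing. -/
def stateA : D.State := fun _ => .A

/-- `D` is `A`-adequate: the graph `G_A(D)` has no loops. -/
def IsAAdequate : Prop := ∀ x, ¬ (stateGraph D.stateA x).IsDiag

/-- The partial presimplicial set `X_D`. -/
def presimplicialSet : PartialPresimplicialSet := graphPresimplicialSet (stateGraph D.stateA)

/-! ### The Khovanov complex -/

/-- Enhanced states: a state `s` and a sign for each circle of `sD`. -/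
abbrev EnhancedState : Type := Σ s : D.State, (Circle s → ℤˣ)

variable {D}

/-- `i(s) = σ(s)`, the number of `A`-labels minus the number of `B`-labels. -/
def iDeg (S : D.EnhancedState) : ℤ :=
  (Finset.univ.filter fun x => S.1 x = .A).card - (Finset.univ.filter fun x => S.1 x = .B).card

/-- `τ(s)`, the sum of the signs. -/
noncomputable def tau (S : D.EnhancedState) : ℤ := ∑ a : Circle S.1, (S.2 a : ℤ)

/-- `j(s) = σ(s) + 2 τ(s)`. -/
noncomputable def jDeg (S : D.EnhancedState) : ℤ := iDeg S + 2 * tau S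

/-- `T` is adjacent to `S`, with `x` the crossing at which the labels differ. The circles common to
both smoothings are those that do not touch `x`. -/
structure AdjacentAt (S T : D.EnhancedState) (x : D.Crossing) : Prop where
  iDeg_eq : iDeg T = iDeg S - 2
  jDeg_eq : jDeg T = jDeg S
  label_left : S.1 x = .A
  label_right : T.1 x = .B
  label_eq : ∀ y, y ≠ x → T.1 y = S.1 y
  sign_eq : ∀ h : D.HalfEdge, (∀ p, circleOf S.1 h ≠ circleOf S.1 (x, p)) →
    T.2 (circleOf T.1 h) = S.2 (circleOf S.1 h)
  sign_loop_eq : ∀ k, T.2 (loopCircle T.1 k) = S.2 (loopCircle S.1 k)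

open Classical in
/-- The incidence number `(S : T)`: it is `(-1)ᵏ`, with `k` the number of `B`-labelled crossings
of `S` after `x`, if `T` is adjacent to `S` and differs from it at `x` (there is at most one such
crossing), and `0` if `T` is not adjacent to `S`. -/
noncomputable def incidence (S T : D.EnhancedState) : ℤ :=
  ∑ x : D.Crossing, if AdjacentAt S T x then
    (-1) ^ (Finset.univ.filter fun y => x < y ∧ S.1 y = .B).card else 0

variable (D)

/-- The enhanced states with `i(s) = i` and `j(s) = j`. -/
abbrev Generator (i j : ℤ) : Type := {S : D.EnhancedState // iDeg S = i ∧ jDeg S = j}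

noncomputable instance (i j : ℤ) : Fintype (D.Generator i j) := Fintype.ofFinite _

/-- The map `C_{i,j}(D) → C_{i',j}(D)`, `s ↦ ∑ₜ (s : t) t`; it is the differential `∂ᵢ` for
`i' = i - 2`, and `0` for other `i'`. -/
noncomputable def khovanovD (i i' j : ℤ) :
    (D.Generator i j →₀ ℤ) →ₗ[ℤ] (D.Generator i' j →₀ ℤ) :=
  Finsupp.linearCombination ℤ fun S : D.Generator i j =>
    ∑ T : D.Generator i' j, incidence S.1 T.1 • Finsupp.single T 1

theorem khovanovD_eq_zero (i i' j : ℤ) (h : i' ≠ i - 2) : D.khovanovD i i' j = 0 := by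
  refine Finsupp.lhom_ext' fun S => LinearMap.ext_ring ?_
  simp only [khovanovD, LinearMap.comp_apply, Finsupp.lsingle_apply, LinearMap.zero_apply,
    Finsupp.linearCombination_single, one_smul]
  refine Finset.sum_eq_zero fun T _ => ?_
  have : incidence S.1 T.1 = 0 := by
    refine Finset.sum_eq_zero fun x _ => if_neg fun hx => h ?_
    have := hx.iDeg_eq
    rw [S.2.1, T.2.1] at this
    exact this
  rw [this, zero_smul]

/-- `∂ ∘ ∂ = 0` in the quantum degree `j`. -/
def KhovanovSquareZero (j : ℤ) : Prop :=
  ∀ i : ℤ, D.khovanovD (i - 2) (i - 2 - 2) j ∘ₗ D.khovanovD i (i - 2) j = 0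

/-- The Khovanov complex `(C_{i,j}(D), ∂ᵢ)` in the quantum degree `j`. Since
`i(s) = 2 |s⁻¹(A)| - c`, it is concentrated in the degrees `i = 2m - c` with `m ≥ 0`, and
`C_{2m-c,j}(D)` is placed in degree `m` here, so that the differential has degree `-1`. -/
noncomputable def khovanovComplex (j : ℤ) (hj : D.KhovanovSquareZero j) :
    ChainComplex (ModuleCat.{0} ℤ) ℕ where
  X m := ModuleCat.of ℤ (D.Generator (2 * m - D.numCrossings) j →₀ ℤ)
  d m m' := ModuleCat.ofHom (D.khovanovD (2 * m - D.numCrossings) (2 * m' - D.numCrossings) j)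
  shape m m' h := by
    rw [khovanovD_eq_zero]
    · rfl
    · intro h'
      apply h
      simp only [ComplexShape.down_Rel]
      omega
  d_comp_d' m m' m'' h h' := by
    have key : ∀ i i' i'' : ℤ, i' = i - 2 → i'' = i' - 2 →
        D.khovanovD i' i'' j ∘ₗ D.khovanovD i i' j = 0 := by
      rintro i i' i'' rfl rfl
      exact hj i
    simp only [ComplexShape.down_Rel] at h h'
    rw [← ModuleCat.ofHom_comp, key _ _ _ (by push_cast [← h]; ring) (by push_cast [← h']; ring)]
    rfl

/-- `j_max(D)`, the maximum of `j(s)` over all enhanced states. -/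
noncomputable def jMax : ℤ := sSup (Set.range (jDeg : D.EnhancedState → ℤ))

/-- `j_almax(D) = j_max(D) - 4`. -/
noncomputable def jAlmax : ℤ := D.jMax - 4

end LinkDiagram

/-!
A state of `D` is given by its set `B` of `B`-labelled crossings. Changing a label changes the
number of circles by at most one, and the change of a first label `A` to `B` merges two circles, as
`D` is adequate. Hence an enhanced state of degree `j_max - 4` is either the state with all labels
`A` and just one negative circle, or a state with `B` nonempty, all circles positive, and
`|s_A D| + |B| - 2` circles. The latter happens if and only if the crossings in `B` are parallel
edges of `G`. So, if `D` has a crossing, the generators are the simplices of `X_D`, together with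
the empty tuple if all edges of `G` are parallel (without crossings there is just one generator, in
the lowest degree), and adjacency is the face relation (`generatorEquiv`, `adjacentAt_iff`).
After a change of signs the Khovanov differential is the alternating sum of the defined faces
(`khovanovD_generatorBasis`).

Circles are counted by linear algebra over the field with two elements. Let `E` and `S` be the
spaces of functions on the half-edges that are invariant under the edge involution and under the
smoothing of the state `s`. The number of circles through half-edges is the dimension of `E ∩ S`.
Each of `E` and `S` is its own orthogonal complement, so `(E ∩ S)ᗮ = E + S`. If two arcs at an
`A`-smoothed crossing lie on different circles, orthogonality shows that the change of the label
merges them (`circleRank_add_one_le`). For parallel crossings (`IsParallel.le_circleRank_stateOf`),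
duality reduces the count to a statement on cycles modulo two. Planarity is used in the form that
such a cycle is the boundary of a colouring of the faces with two colours
(`DiagramData.exists_coloring`): this is a comparison of dimensions in which the equation defining
planarity is just what is needed. The arguments that would use the two sides of a circle are
replaced by the remark that the product of two colourings is a colouring.

If `X_D` is not proper, the Khovanov complex and the augmented cellular complex are isomorphic. If
it is proper, not all edges of `G` are parallel, the Khovanov complex vanishes in its lowest degree,
and the cellular complex has in addition the base vertex `b` and the generator in dimension `-1`,
which cancel each other: a vertex `a` corresponds to `a - b` (`homotopyEquiv`).
-/

/-! ### Linear algebra over the field with two elements -/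

namespace ModTwo

/-- The functions with values in the field with two elements that are constant along a relation. -/
def invariants {α : Type*} (r : α → α → Prop) : Submodule (ZMod 2) (α → ZMod 2) where
  carrier := {f | ∀ a b, r a b → f a = f b}
  add_mem' hf hg a b h := by rw [Pi.add_apply, Pi.add_apply, hf a b h, hg a b h]
  zero_mem' _ _ _ := rfl
  smul_mem' c f hf a b h := by rw [Pi.smul_apply, Pi.smul_apply, hf a b h]

/-- Functions constant along a relation are functions on its quotient. -/
def invariantsEquiv {α : Type*} (r : α → α → Prop) :
    (Quot r → ZMod 2) ≃ₗ[ZMod 2] invariants r where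
  toFun g := ⟨fun a => g (Quot.mk r a), fun _ _ h => congrArg g (Quot.sound h)⟩
  map_add' _ _ := rfl
  map_smul' _ _ := rfl
  invFun f := Quot.lift f.1 f.2
  left_inv _ := funext (Quot.ind fun _ => rfl)
  right_inv _ := rfl

theorem finrank_invariants {α : Type*} [Finite α] (r : α → α → Prop) :
    Module.finrank (ZMod 2) (invariants r) = Nat.card (Quot r) := by
  have := Fintype.ofFinite (Quot r)
  rw [← (invariantsEquiv r).finrank_eq, Module.finrank_pi, Nat.card_eq_fintype_card]

/-- The standard bilinear form on functions with values in the field with two elements. -/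
def dot (ι : Type*) [Fintype ι] : LinearMap.BilinForm (ZMod 2) (ι → ZMod 2) :=
  dotProductBilin (ZMod 2) (ZMod 2)

variable {ι : Type*} [Fintype ι]

theorem dot_apply (v w : ι → ZMod 2) : dot ι v w = ∑ i, v i * w i := rfl

theorem dot_isRefl : (dot ι).IsRefl := fun v w h => by
  rw [dot_apply] at h ⊢
  simpa only [mul_comm] using h

theorem dot_nondegenerate : (dot ι).Nondegenerate := by
  classical
  refine (LinearMap.IsRefl.nondegenerate_iff_separatingLeft dot_isRefl).mpr fun v hv => ?_
  funext i
  have := hv (Pi.single i 1)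
  rw [dot_apply] at this
  simpa [Pi.single_apply] using this

theorem mem_orthogonal {W : Submodule (ZMod 2) (ι → ZMod 2)} {w : ι → ZMod 2} :
    w ∈ (dot ι).orthogonal W ↔ ∀ z ∈ W, ∑ i, z i * w i = 0 := Iff.rfl

theorem sum_eq_zero_of_involution {f : ι → ZMod 2} {σ : ι → ι} (h1 : ∀ i, σ (σ i) = i)
    (h2 : ∀ i, σ i ≠ i) (hf : ∀ i, f (σ i) = f i) : ∑ i, f i = 0 :=
  Finset.sum_involution (fun i _ => σ i) (fun i _ => by rw [hf]; exact CharTwo.add_self_eq_zero _)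
    (fun i _ _ => h2 i) (fun _ _ => Finset.mem_univ _) (fun i _ => h1 i)

/-- The functions invariant under an involution without fixed points form a Lagrangian subspace. -/
theorem orthogonal_invariants {σ : ι → ι} (h1 : ∀ i, σ (σ i) = i) (h2 : ∀ i, σ i ≠ i) :
    (dot ι).orthogonal (invariants fun i j => j = σ i) = invariants fun i j => j = σ i := by
  classical
  ext w
  rw [mem_orthogonal]
  constructor
  · rintro h i _ rfl
    have := h (Pi.single i 1 + Pi.single (σ i) 1) (by
      rintro j _ rfl
      have e1 : σ j = i ↔ j = σ i := ⟨fun h => by rw [← h, h1], fun h => by rw [h, h1]⟩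
      have e2 : σ j = σ i ↔ j = i := ⟨fun h => by rw [← h1 j, h, h1], fun h => by rw [h]⟩
      simp only [Pi.add_apply, Pi.single_apply, e1, e2]
      exact add_comm _ _)
    simp only [Pi.add_apply, add_mul, Finset.sum_add_distrib, Pi.single_apply, ite_mul, one_mul,
      zero_mul, Finset.sum_ite_eq', Finset.mem_univ, if_true] at this
    exact CharTwo.add_eq_zero.mp this
  · intro h z hz
    refine sum_eq_zero_of_involution h1 h2 fun i => ?_
    rw [← hz i _ rfl, ← h i _ rfl]

theorem two_mul_finrank_invariants {σ : ι → ι} (h1 : ∀ i, σ (σ i) = i) (h2 : ∀ i, σ i ≠ i) :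
    2 * Module.finrank (ZMod 2) (invariants fun i j => j = σ i) = Fintype.card ι := by
  have h := LinearMap.BilinForm.finrank_orthogonal dot_nondegenerate
    (invariants fun i j : ι => j = σ i)
  rw [orthogonal_invariants h1 h2, Module.finrank_pi] at h
  have h' := Submodule.finrank_le (invariants fun i j : ι => j = σ i)
  rw [Module.finrank_pi] at h'
  omega

/-- A vector orthogonal to the common invariants of two involutions without fixed points is a sum
of invariant vectors. -/
theorem exists_add_of_orthogonal {σ τ : ι → ι} (hσ1 : ∀ i, σ (σ i) = i) (hσ2 : ∀ i, σ i ≠ i)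
    (hτ1 : ∀ i, τ (τ i) = i) (hτ2 : ∀ i, τ i ≠ i) {w : ι → ZMod 2}
    (hw : ∀ z : ι → ZMod 2, (∀ i, z (σ i) = z i) → (∀ i, z (τ i) = z i) → ∑ i, z i * w i = 0) :
    ∃ u v : ι → ZMod 2, (∀ i, u (σ i) = u i) ∧ (∀ i, v (τ i) = v i) ∧ w = u + v := by
  set U := invariants fun i j => j = σ i with hU
  set V := invariants fun i j => j = τ i with hV
  have hmem : w ∈ (dot ι).orthogonal ((dot ι).orthogonal (U ⊔ V)) := by
    rw [mem_orthogonal]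
    intro z hz
    refine hw z (fun i => ?_) (fun i => ?_)
    · have : z ∈ (dot ι).orthogonal U := LinearMap.BilinForm.orthogonal_le le_sup_left hz
      rw [hU, orthogonal_invariants hσ1 hσ2] at this
      exact (this i _ rfl).symm
    · have : z ∈ (dot ι).orthogonal V := LinearMap.BilinForm.orthogonal_le le_sup_right hz
      rw [hV, orthogonal_invariants hτ1 hτ2] at this
      exact (this i _ rfl).symm
  rw [LinearMap.BilinForm.orthogonal_orthogonal dot_nondegenerate dot_isRefl] at hmem
  obtain ⟨u, hu, v, hv, rfl⟩ := Submodule.mem_sup.mp hmem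
  exact ⟨u, v, fun i => (hu i _ rfl).symm, fun i => (hv i _ rfl).symm, rfl⟩

theorem card_le_finrank_range_add {W : Type*} [AddCommGroup W] [Module (ZMod 2) W]
    (f : W →ₗ[ZMod 2] ι → ZMod 2) {A : Submodule (ZMod 2) (ι → ZMod 2)}
    (hA : ∀ a : ι → ZMod 2, (∀ z, ∑ i, f z i * a i = 0) → a ∈ A) :
    Fintype.card ι ≤ Module.finrank (ZMod 2) (LinearMap.range f) + Module.finrank (ZMod 2) A := by
  have h := LinearMap.BilinForm.finrank_orthogonal dot_nondegenerate (LinearMap.range f)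
  rw [Module.finrank_pi] at h
  have h2 : (dot ι).orthogonal (LinearMap.range f) ≤ A := fun a ha =>
    hA a fun z => ha (f z) ⟨z, rfl⟩
  have := Submodule.finrank_mono h2
  omega

/-- A subspace cut out of another one by one linear condition has codimension at most one. -/
theorem finrank_le_finrank_add_one {V : Type*} [AddCommGroup V] [Module (ZMod 2) V]
    [FiniteDimensional (ZMod 2) V] {W U : Submodule (ZMod 2) V} (f : V →ₗ[ZMod 2] ZMod 2)
    (h : ∀ z ∈ W, f z = 0 → z ∈ U) :
    Module.finrank (ZMod 2) W ≤ Module.finrank (ZMod 2) U + 1 := by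
  have h1 := LinearMap.finrank_range_add_finrank_ker (f.domRestrict W)
  have h2 : Module.finrank (ZMod 2) (LinearMap.range (f.domRestrict W)) ≤ 1 := by
    simpa using Submodule.finrank_le (LinearMap.range (f.domRestrict W))
  have h3 : Module.finrank (ZMod 2) (LinearMap.ker (f.domRestrict W)) ≤
      Module.finrank (ZMod 2) U := by
    rw [← Submodule.finrank_map_subtype_eq W]
    refine Submodule.finrank_mono ?_
    rintro _ ⟨z, hz, rfl⟩
    exact h z z.2 hz
  omega

end ModTwo

/-! ### Planarity: cycles are boundaries -/

namespace DiagramData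

variable (D : DiagramData)

theorem card_halfEdge : Fintype.card D.HalfEdge = 4 * D.numCrossings := by
  simp [HalfEdge, Crossing, mul_comm]

/-- On a planar diagram, a set of edges that contains an even number of the half-edges at each
crossing is the set of edges at which some colouring of the faces with two colours changes. The
colouring is given as a function on corners: the face to the right of the half-edge `h`, seen from
its crossing, is the face to the right of `rot (edge h)`. -/
theorem exists_coloring (hD : D.IsPlanar) {e : D.HalfEdge → ZMod 2}
    (he : ∀ h, e (D.edge h) = e h) (hv : ∀ x, ∑ i, e (x, i) = 0) :
    ∃ φ : D.HalfEdge → ZMod 2, (∀ h, φ (D.rot (D.edge h)) = φ h) ∧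
      ∀ h, e h = φ h + φ (D.rot h) := by
  classical
  -- the coboundary map and the map `e ↦ (x ↦ ∑ i, e (x, i))`, whose kernel is the cycle space
  let F := ModTwo.invariants fun h h' : D.HalfEdge => h' = D.rot (D.edge h)
  let E := ModTwo.invariants fun h h' : D.HalfEdge => h' = D.edge h
  let K := ModTwo.invariants fun h h' : D.HalfEdge => h' = D.edge h ∨ h' = D.rot h
  have hF : ∀ φ ∈ F, ∀ h, φ (D.rot h) = φ (D.edge h) := fun φ hφ h => by
    have := hφ (D.edge h) _ rfl
    rw [D.edge_edge] at this
    exact this.symm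
  let d : F →ₗ[ZMod 2] E :=
    { toFun := fun φ => ⟨fun h => φ.1 h + φ.1 (D.rot h), by
        rintro h _ rfl
        dsimp only
        rw [hF φ.1 φ.2 h, ← φ.2 h _ rfl]
        exact add_comm _ _⟩
      map_add' := fun φ ψ => Subtype.ext (funext fun h => add_add_add_comm _ _ _ _)
      map_smul' := fun c φ => Subtype.ext (funext fun h => (mul_add c (φ.1 h) _).symm) }
  let s : E →ₗ[ZMod 2] D.Crossing → ZMod 2 :=
    { toFun := fun e x => ∑ i, e.1 (x, i)
      map_add' := fun e e' => funext fun x => Finset.sum_add_distrib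
      map_smul' := fun c e => funext fun x => (Finset.mul_sum _ _ _).symm }
  have hle : LinearMap.range d ≤ LinearMap.ker s := by
    rintro _ ⟨φ, rfl⟩
    refine LinearMap.mem_ker.mpr (funext fun x => ?_)
    change ∑ i : Fin 4, (φ.1 (x, i) + φ.1 (x, i + 1)) = 0
    rw [Finset.sum_add_distrib]
    have h := Equiv.sum_comp (Equiv.addRight (1 : Fin 4)) fun i => φ.1 (x, i)
    rw [Equiv.coe_addRight] at h
    rw [h]
    exact CharTwo.add_self_eq_zero _
  have hK : Module.finrank (ZMod 2) K = Nat.card D.Component := ModTwo.finrank_invariants _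
  have hFr : Module.finrank (ZMod 2) F = Nat.card D.Face := ModTwo.finrank_invariants _
  have hEr : 2 * Module.finrank (ZMod 2) E = 4 * D.numCrossings := by
    rw [← D.card_halfEdge]
    exact ModTwo.two_mul_finrank_invariants D.edge_edge D.edge_ne
  have hd := LinearMap.finrank_range_add_finrank_ker d
  have hs := LinearMap.finrank_range_add_finrank_ker s
  -- a colouring with zero coboundary is constant on the components
  have hkd : Module.finrank (ZMod 2) (LinearMap.ker d) ≤ Module.finrank (ZMod 2) K := by
    rw [← Submodule.finrank_map_subtype_eq F]
    refine Submodule.finrank_mono ?_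
    rintro _ ⟨φ, hφ, rfl⟩
    have hφ' : ∀ h, φ.1 h = φ.1 (D.rot h) := fun h =>
      CharTwo.add_eq_zero.mp (congrFun (congrArg Subtype.val (LinearMap.mem_ker.mp hφ)) h)
    rintro h _ (rfl | rfl)
    · exact (hφ' h).trans (hF φ.1 φ.2 h)
    · exact hφ' h
  -- a combination of crossings that is orthogonal to all vertex sums is constant on the components
  have hrs : Fintype.card D.Crossing ≤ Module.finrank (ZMod 2) (LinearMap.range s) +
      Module.finrank (ZMod 2) K := by
    let π : (D.Crossing → ZMod 2) →ₗ[ZMod 2] D.HalfEdge → ZMod 2 :=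
      LinearMap.funLeft (ZMod 2) (ZMod 2) Prod.fst
    have hπ : Function.Injective π :=
      LinearMap.funLeft_injective_of_surjective _ _ _ fun x => ⟨(x, 0), rfl⟩
    refine (ModTwo.card_le_finrank_range_add s (A := K.comap π) fun a ha => ?_).trans ?_
    · have : π a ∈ (ModTwo.dot D.HalfEdge).orthogonal E := by
        rw [ModTwo.mem_orthogonal]
        intro z hz
        rw [← ha ⟨z, hz⟩, Fintype.sum_prod_type]
        exact Finset.sum_congr rfl fun x _ =>
          (Finset.sum_mul Finset.univ (fun i => z (x, i)) (a x)).symm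
      rw [ModTwo.orthogonal_invariants D.edge_edge D.edge_ne] at this
      rintro h _ (rfl | rfl)
      · exact this h _ rfl
      · rfl
    · gcongr
      rw [LinearEquiv.finrank_eq (Submodule.equivMapOfInjective π hπ _)]
      exact Submodule.finrank_mono (Submodule.map_comap_le _ _)
  rw [Fintype.card_fin] at hrs
  have hpl : Nat.card D.Face = D.numCrossings + 2 * Nat.card D.Component := hD
  have heq : LinearMap.range d = LinearMap.ker s :=
    Submodule.eq_of_le_of_finrank_le hle (by omega)
  have hmem : (⟨e, fun h _ hh => by rw [hh, he]⟩ : E) ∈ LinearMap.range d := by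
    rw [heq]
    exact LinearMap.mem_ker.mpr (funext hv)
  obtain ⟨φ, hφ⟩ := hmem
  exact ⟨φ.1, fun h => (φ.2 h _ rfl).symm,
    fun h => (congrFun (congrArg Subtype.val hφ) h).symm⟩

end DiagramData

/-! ### Counting the circles of a state -/

namespace LinkDiagram

open ModTwo

theorem smoothEnd_smoothEnd (l : Label) (i : Fin 4) : smoothEnd l (smoothEnd l i) = i := by
  cases l <;> fin_cases i <;> rfl

theorem smoothEnd_ne (l : Label) (i : Fin 4) : smoothEnd l i ≠ i := by
  cases l <;> fin_cases i <;> decide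

variable {D : LinkDiagram}

theorem smooth_smooth (s : D.State) (h : D.HalfEdge) : smooth s (smooth s h) = h :=
  Prod.ext rfl (smoothEnd_smoothEnd _ _)

theorem smooth_ne (s : D.State) (h : D.HalfEdge) : smooth s h ≠ h := fun e =>
  smoothEnd_ne _ _ (congrArg Prod.snd e)

theorem smooth_invariant_A {s : D.State} {z : D.HalfEdge → ZMod 2}
    (hz : ∀ h, z (smooth s h) = z h) {x : D.Crossing} (hx : s x = .A) :
    z (x, 0) = z (x, 1) ∧ z (x, 2) = z (x, 3) := by
  have h1 := hz (x, 1)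
  have h3 := hz (x, 3)
  simp only [smooth, hx] at h1 h3
  exact ⟨h1, h3⟩

theorem smooth_invariant_B {s : D.State} {z : D.HalfEdge → ZMod 2}
    (hz : ∀ h, z (smooth s h) = z h) {x : D.Crossing} (hx : s x = .B) :
    z (x, 0) = z (x, 3) ∧ z (x, 1) = z (x, 2) := by
  have h2 := hz (x, 2)
  have h3 := hz (x, 3)
  simp only [smooth, hx] at h2 h3
  exact ⟨h3, h2⟩

theorem smooth_invariant_of {s : D.State} {z : D.HalfEdge → ZMod 2}
    (hA : ∀ x, s x = .A → z (x, 0) = z (x, 1) ∧ z (x, 2) = z (x, 3))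
    (hB : ∀ x, s x = .B → z (x, 0) = z (x, 3) ∧ z (x, 1) = z (x, 2)) (h : D.HalfEdge) :
    z (smooth s h) = z h := by
  obtain ⟨x, i⟩ := h
  cases hx : s x
  · obtain ⟨h1, h2⟩ := hA x hx
    simp only [smooth, hx]
    fin_cases i
    exacts [h1.symm, h1, h2.symm, h2]
  · obtain ⟨h1, h2⟩ := hB x hx
    simp only [smooth, hx]
    fin_cases i
    exacts [h1.symm, h2.symm, h2, h1]

/-- The space of the functions on the half-edges, with values in the field with two elements, that
are constant on the circles of a state. -/
def circleSpace (s : D.State) : Submodule (ZMod 2) (D.HalfEdge → ZMod 2) :=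
  invariants fun h h' : D.HalfEdge => h' = D.edge h ∨ h' = smooth s h

theorem mem_circleSpace {s : D.State} {z : D.HalfEdge → ZMod 2} :
    z ∈ circleSpace s ↔ (∀ h, z (D.edge h) = z h) ∧ ∀ h, z (smooth s h) = z h :=
  ⟨fun hz => ⟨fun h => (hz h _ (Or.inl rfl)).symm, fun h => (hz h _ (Or.inr rfl)).symm⟩,
    fun hz h h' hh => by
      rcases hh with rfl | rfl
      exacts [(hz.1 h).symm, (hz.2 h).symm]⟩

/-- The number of circles of a state that run through half-edges. -/
noncomputable def circleRank (s : D.State) : ℕ := Module.finrank (ZMod 2) (circleSpace s)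

theorem card_circle (s : D.State) : Fintype.card (Circle s) = circleRank s + D.numLoops := by
  rw [circleRank, circleSpace, finrank_invariants, ← Nat.card_eq_fintype_card, Circle,
    Nat.card_sum, Nat.card_fin]

theorem eq_of_circleOf_eq {s : D.State} {z : D.HalfEdge → ZMod 2} (hz : z ∈ circleSpace s)
    {h h' : D.HalfEdge} (e : circleOf s h = circleOf s h') : z h = z h' :=
  congrArg (Quot.lift z hz) (Sum.inl_injective e)

open Classical in
/-- The indicator function of the half-edges on a circle. -/
noncomputable def indicator (s : D.State) (a : Circle s) (h : D.HalfEdge) : ZMod 2 :=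
  if circleOf s h = a then 1 else 0

theorem circleOf_edge (s : D.State) (h : D.HalfEdge) : circleOf s (D.edge h) = circleOf s h :=
  (congrArg Sum.inl (Quot.sound (r := fun h h' : D.HalfEdge => h' = D.edge h ∨ h' = smooth s h)
    (Or.inl rfl))).symm

theorem circleOf_smooth (s : D.State) (h : D.HalfEdge) :
    circleOf s (smooth s h) = circleOf s h :=
  (congrArg Sum.inl (Quot.sound (r := fun h h' : D.HalfEdge => h' = D.edge h ∨ h' = smooth s h)
    (Or.inr rfl))).symm

theorem indicator_mem (s : D.State) (a : Circle s) : indicator s a ∈ circleSpace s :=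
  mem_circleSpace.mpr ⟨fun h => by rw [indicator, indicator, circleOf_edge],
    fun h => by rw [indicator, indicator, circleOf_smooth]⟩

theorem indicator_of_eq {s : D.State} {a : Circle s} {h : D.HalfEdge} (e : circleOf s h = a) :
    indicator s a h = 1 := if_pos e

theorem indicator_of_ne {s : D.State} {a : Circle s} {h : D.HalfEdge} (e : circleOf s h ≠ a) :
    indicator s a h = 0 := if_neg e

/-- A function that is constant on the circles of a state and takes only one value at the crossing
`x` is constant on the circles of every state that agrees with the given one away from `x`. -/
theorem mem_circleSpace_of_eq_off {s t : D.State} {z : D.HalfEdge → ZMod 2}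
    (hz : z ∈ circleSpace s) (h : ∀ x, s x ≠ t x → z (x, 0) = z (x, 1) ∧ z (x, 0) = z (x, 2) ∧
      z (x, 0) = z (x, 3)) : z ∈ circleSpace t := by
  obtain ⟨h1, h2⟩ := mem_circleSpace.mp hz
  refine mem_circleSpace.mpr ⟨h1, smooth_invariant_of (fun x hx => ?_) fun x hx => ?_⟩
  · by_cases e : s x = t x
    · exact smooth_invariant_A h2 (e.trans hx)
    · obtain ⟨e1, e2, e3⟩ := h x e
      exact ⟨e1, e2.symm.trans e3⟩
  · by_cases e : s x = t x
    · exact smooth_invariant_B h2 (e.trans hx)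
    · obtain ⟨e1, e2, e3⟩ := h x e
      exact ⟨e3, e1.symm.trans e2⟩

/-- Changing one label changes the number of circles by at most one. -/
theorem circleRank_le_add_one {s t : D.State} {x : D.Crossing} (hst : ∀ y, y ≠ x → s y = t y) :
    circleRank s ≤ circleRank t + 1 := by
  let f : (D.HalfEdge → ZMod 2) →ₗ[ZMod 2] ZMod 2 :=
    LinearMap.proj (R := ZMod 2) (φ := fun _ : D.HalfEdge => ZMod 2) (x, 0) +
      LinearMap.proj (x, 2)
  refine finrank_le_finrank_add_one f fun z hz hf => mem_circleSpace_of_eq_off hz fun y hy => ?_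
  obtain rfl : y = x := by_contra fun h => hy (hst y h)
  have h02 : z (y, 0) = z (y, 2) := CharTwo.add_eq_zero.mp hf
  cases hs : s y
  · obtain ⟨h1, h2⟩ := smooth_invariant_A (mem_circleSpace.mp hz).2 hs
    exact ⟨h1, h02, h02.trans h2⟩
  · obtain ⟨h1, h2⟩ := smooth_invariant_B (mem_circleSpace.mp hz).2 hs
    exact ⟨h02.trans h2.symm, h02, h1⟩

/-- If the two arcs of an `A`-smoothed crossing lie on different circles, then changing the label
to `B` merges these circles. The function `χ` separates the two circles. Given a function `z` that
is constant on the new circles, the sum of `z * χ` over all half-edges vanishes, as the edges match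
them in pairs; away from the crossing the smoothings match them as well, and what remains shows
that `z` takes only one value at the crossing. -/
theorem circleRank_add_one_le {s t : D.State} {x : D.Crossing} (hst : ∀ y, y ≠ x → s y = t y)
    (hs : s x = .A) (ht : t x = .B) {χ : D.HalfEdge → ZMod 2} (hχ : χ ∈ circleSpace s)
    (hχx : χ (x, 0) ≠ χ (x, 2)) : circleRank t + 1 ≤ circleRank s := by
  obtain ⟨c1, c2⟩ := mem_circleSpace.mp hχ
  obtain ⟨cx1, cx2⟩ := smooth_invariant_A c2 hs
  refine Nat.succ_le_of_lt (Submodule.finrank_lt_finrank_of_lt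
    (lt_of_le_of_ne (fun z hz => ?_) fun e => ?_))
  · obtain ⟨z1, z2⟩ := mem_circleSpace.mp hz
    obtain ⟨zx1, zx2⟩ := smooth_invariant_B z2 ht
    have hsum : ∑ h, z h * χ h = 0 :=
      sum_eq_zero_of_involution D.edge_edge D.edge_ne fun h => by rw [z1, c1]
    rw [Fintype.sum_prod_type, Fintype.sum_eq_single x fun y hy => ?_] at hsum
    · rw [Fin.sum_univ_four] at hsum
      refine mem_circleSpace_of_eq_off hz fun y hy => ?_
      obtain rfl : y = x := by_contra fun h => hy (hst y h).symm
      have : z (y, 0) = z (y, 1) := by grind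
      exact ⟨this, this.trans zx2, zx1⟩
    · rw [Fin.sum_univ_four]
      cases hy' : s y
      · obtain ⟨a1, a2⟩ := smooth_invariant_A c2 hy'
        obtain ⟨b1, b2⟩ := smooth_invariant_A z2 ((hst y hy).symm.trans hy')
        grind
      · obtain ⟨a1, a2⟩ := smooth_invariant_B c2 hy'
        obtain ⟨b1, b2⟩ := smooth_invariant_B z2 ((hst y hy).symm.trans hy')
        grind
  · rw [← e] at hχ
    obtain ⟨e1, e2⟩ := smooth_invariant_B (mem_circleSpace.mp hχ).2 ht
    exact hχx (cx1.trans e2)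

/-- The state with `B`-labels at the given crossings. -/
def stateOf (B : Finset D.Crossing) : D.State := fun x => if x ∈ B then .B else .A

theorem stateOf_of_mem {B : Finset D.Crossing} {x : D.Crossing} (h : x ∈ B) :
    stateOf B x = .B := if_pos h

theorem stateOf_of_notMem {B : Finset D.Crossing} {x : D.Crossing} (h : x ∉ B) :
    stateOf B x = .A := if_neg h

theorem stateOf_insert_of_ne {B : Finset D.Crossing} {x y : D.Crossing} (h : y ≠ x) :
    stateOf (insert x B) y = stateOf B y := by
  simp [stateOf, Finset.mem_insert, h]

theorem circleRank_stateOf_union_le (B B' : Finset D.Crossing) :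
    circleRank (stateOf (B ∪ B')) ≤ circleRank (stateOf B) + B'.card := by
  induction B' using Finset.induction_on with
  | empty => simp
  | insert x B' hx ih =>
    rw [Finset.union_insert, Finset.card_insert_of_notMem hx]
    have := circleRank_le_add_one (s := stateOf (insert x (B ∪ B'))) (t := stateOf (B ∪ B'))
      fun y hy => stateOf_insert_of_ne hy
    omega

theorem circleRank_stateOf_le_of_subset {B B' : Finset D.Crossing} (h : B ⊆ B') :
    circleRank (stateOf B') + B.card ≤ circleRank (stateOf B) + B'.card := by
  have := circleRank_stateOf_union_le B (B' \ B)
  rw [Finset.union_sdiff_of_subset h, Finset.card_sdiff_of_subset h] at this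
  have := Finset.card_le_card h
  omega

theorem stateOf_empty : stateOf ∅ = D.stateA := by
  funext x
  simp [stateOf, stateA]

theorem circleOf_ne (hA : D.IsAAdequate) (x : D.Crossing) :
    circleOf D.stateA (x, 0) ≠ circleOf D.stateA (x, 2) :=
  fun h => hA x (Sym2.mk_isDiag_iff.mpr h)

/-- As soon as there is a `B`-labelled crossing, the number of circles falls short by at least two
of the bound in which every `B`-label adds a circle: the first `B`-label merges two circles. -/
theorem circleRank_stateOf_le (hA : D.IsAAdequate) {B : Finset D.Crossing} (hB : B.Nonempty) :
    circleRank (stateOf B) + 2 ≤ circleRank D.stateA + B.card := by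
  obtain ⟨x, hx⟩ := hB
  have h1 := circleRank_stateOf_le_of_subset (Finset.singleton_subset_iff.mpr hx)
  have h2 : circleRank (stateOf {x}) + 1 ≤ circleRank D.stateA := by
    refine circleRank_add_one_le (x := x) (fun y hy => ?_) rfl
      (stateOf_of_mem (Finset.mem_singleton_self x))
      (indicator_mem D.stateA (circleOf D.stateA (x, 0))) ?_
    · exact (stateOf_of_notMem (by simpa using hy)).symm
    · rw [indicator_of_eq rfl, indicator_of_ne fun e => circleOf_ne hA x e.symm]
      exact one_ne_zero
  rw [Finset.card_singleton] at h1
  omega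

/-- If two `B`-labelled crossings are not parallel, then the number of circles falls short of that
bound by at least four: each of the two labels merges two circles. -/
theorem circleRank_stateOf_lt (hA : D.IsAAdequate) {B : Finset D.Crossing} {x y : D.Crossing}
    (hx : x ∈ B) (hy : y ∈ B) (hxy : stateGraph D.stateA x ≠ stateGraph D.stateA y) :
    circleRank (stateOf B) + 4 ≤ circleRank D.stateA + B.card := by
  have hne : x ≠ y := fun e => hxy (by rw [e])
  -- one end `a` of the edge `y` is not an end of the edge `x`
  obtain ⟨a, hay, hax⟩ : ∃ a, (indicator D.stateA a (y, 0) ≠ indicator D.stateA a (y, 2)) ∧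
      a ≠ circleOf D.stateA (x, 0) ∧ a ≠ circleOf D.stateA (x, 2) := by
    have hy0 := circleOf_ne hA y
    by_cases h : circleOf D.stateA (y, 0) ≠ circleOf D.stateA (x, 0) ∧
        circleOf D.stateA (y, 0) ≠ circleOf D.stateA (x, 2)
    · refine ⟨_, ?_, h⟩
      rw [indicator_of_eq rfl, indicator_of_ne hy0.symm]
      exact one_ne_zero
    · refine ⟨circleOf D.stateA (y, 2), ?_, ?_⟩
      · rw [indicator_of_eq rfl, indicator_of_ne hy0]
        exact zero_ne_one
      · by_contra h'
        refine hxy (Sym2.eq_iff.mpr ?_)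
        grind
  have h0 : circleRank (stateOf {x}) + 1 ≤ circleRank D.stateA :=
    circleRank_add_one_le (x := x) (fun z hz => (stateOf_of_notMem (by simpa using hz)).symm) rfl
      (stateOf_of_mem (Finset.mem_singleton_self x))
      (indicator_mem D.stateA (circleOf D.stateA (x, 0))) (by
        rw [indicator_of_eq rfl, indicator_of_ne fun e => circleOf_ne hA x e.symm]
        exact one_ne_zero)
  have ha : indicator D.stateA a ∈ circleSpace (stateOf {x}) := by
    refine mem_circleSpace_of_eq_off (indicator_mem _ _) fun z hz => ?_
    obtain rfl : z = x := by
      by_contra h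
      exact hz (stateOf_of_notMem (by simpa using h)).symm
    obtain ⟨h1, h2⟩ := smooth_invariant_A (mem_circleSpace.mp (indicator_mem D.stateA a)).2
      (x := z) rfl
    rw [← h1, ← h2, indicator_of_ne hax.1.symm, indicator_of_ne hax.2.symm]
    exact ⟨rfl, rfl, rfl⟩
  have h1 : circleRank (stateOf {y, x}) + 1 ≤ circleRank (stateOf {x}) :=
    circleRank_add_one_le (x := y) (fun z hz => (stateOf_insert_of_ne hz).symm)
      (stateOf_of_notMem (by simpa using hne.symm)) (stateOf_of_mem (by simp)) ha hay
  have h2 := circleRank_stateOf_le_of_subset (B := {y, x}) (B' := B) (by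
    intro z hz
    rcases Finset.mem_insert.mp hz with rfl | hz
    · exact hy
    · rwa [Finset.mem_singleton.mp hz])
  rw [Finset.card_pair hne.symm] at h2
  omega

/-! ### Parallel crossings -/

/-- A colouring of the faces that takes the same value at any two corners joined by an
`A`-smoothing changes only along the circles of the state with all labels `A`, and along each of
them either everywhere or nowhere. -/
theorem coboundary_mem {φ : D.HalfEdge → ZMod 2} (hφ : ∀ h, φ (D.rot (D.edge h)) = φ h)
    (h : ∀ x, φ (x, 2) = φ (x, 0)) :
    (fun h => φ h + φ (D.rot h)) ∈ circleSpace D.stateA := by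
  refine mem_circleSpace.mpr ⟨fun h => ?_, smooth_invariant_of
    (z := fun h => φ h + φ (D.rot h)) (fun x _ => ⟨?_, ?_⟩) fun x hx => Label.noConfusion hx⟩
  · have := hφ (D.edge h)
    rw [D.edge_edge] at this
    rw [hφ, this]
    exact add_comm _ _
  · change φ (x, 0) + φ (x, 1) = φ (x, 1) + φ (x, 2)
    rw [h, add_comm]
  · change φ (x, 2) + φ (x, 3) = φ (x, 3) + φ (x, 0)
    rw [h, add_comm]

theorem exists_coloring_indicator (a : Circle D.stateA) :
    ∃ ψ : D.HalfEdge → ZMod 2, (∀ h, ψ (D.rot (D.edge h)) = ψ h) ∧ (∀ x, ψ (x, 2) = ψ (x, 0)) ∧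
      ∀ h, indicator D.stateA a h = ψ h + ψ (D.rot h) := by
  obtain ⟨h1, h2⟩ := mem_circleSpace.mp (indicator_mem D.stateA a)
  have h3 : ∀ x : D.Crossing, _ := fun x => smooth_invariant_A h2 (x := x) rfl
  obtain ⟨ψ, hψ, hψ'⟩ := D.exists_coloring D.planar h1 fun x => by
    rw [Fin.sum_univ_four, (h3 x).1, (h3 x).2]
    grind
  refine ⟨ψ, hψ, fun x => ?_, hψ'⟩
  have e0 : _ = ψ (x, 0) + ψ (x, 1) := hψ' (x, 0)
  have e1 : _ = ψ (x, 1) + ψ (x, 2) := hψ' (x, 1)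
  have := (h3 x).1
  grind

/-- The crossings in `B` join the distinct circles `a` and `b`. -/
structure IsParallel (B : Finset D.Crossing) (a b : Circle D.stateA) : Prop where
  ne : a ≠ b
  ends : ∀ x ∈ B, circleOf D.stateA (x, 0) = a ∧ circleOf D.stateA (x, 2) = b ∨
    circleOf D.stateA (x, 0) = b ∧ circleOf D.stateA (x, 2) = a

theorem IsParallel.symm {B : Finset D.Crossing} {a b : Circle D.stateA} (h : IsParallel B a b) :
    IsParallel B b a := ⟨h.ne.symm, fun x hx => (h.ends x hx).symm⟩

/-- The chords that join the circles `a` and `b` lie on the same side of `a`, namely that of `b`.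
Here `ψ` colours the two sides of `a`. It is constant along `b`: multiplied by a colouring of the
two sides of `b`, it still changes only along circles, and the change along `b` is the value of `ψ`
there. -/
theorem IsParallel.exists_side {B : Finset D.Crossing} {a b : Circle D.stateA}
    (hB : IsParallel B a b) {ψ : D.HalfEdge → ZMod 2} (h1 : ∀ h, ψ (D.rot (D.edge h)) = ψ h)
    (h2 : ∀ x, ψ (x, 2) = ψ (x, 0)) (h3 : ∀ h, indicator D.stateA a h = ψ h + ψ (D.rot h)) :
    ∃ τ, ∀ x ∈ B, ψ (x, 0) = τ := by
  obtain ⟨ω, w1, w2, w3⟩ := exists_coloring_indicator b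
  have hmem : (fun h => ψ h * ω h + ψ (D.rot h) * ω (D.rot h)) ∈ circleSpace D.stateA :=
    coboundary_mem (φ := fun h => ψ h * ω h) (fun h => by rw [h1, w1]) fun x => by rw [h2, w2]
  have key : ∀ h, circleOf D.stateA h = b →
      ψ h * ω h + ψ (D.rot h) * ω (D.rot h) = ψ h := fun h hh => by
    have e1 := h3 h
    have e2 := w3 h
    rw [indicator_of_ne (by rw [hh]; exact hB.ne.symm)] at e1
    rw [indicator_of_eq hh] at e2
    grind
  have key' : ∀ x ∈ B, ∃ h, circleOf D.stateA h = b ∧ ψ h = ψ (x, 0) := fun x hx => by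
    rcases hB.ends x hx with ⟨-, h⟩ | ⟨h, -⟩
    exacts [⟨_, h, h2 x⟩, ⟨_, h, rfl⟩]
  rcases B.eq_empty_or_nonempty with rfl | ⟨x₀, hx₀⟩
  · exact ⟨0, by simp⟩
  refine ⟨ψ (x₀, 0), fun x hx => ?_⟩
  obtain ⟨h, e1, e2⟩ := key' x hx
  obtain ⟨h', e1', e2'⟩ := key' x₀ hx₀
  rw [← e2, ← e2', ← key h e1, ← key h' e1']
  exact eq_of_circleOf_eq hmem (e1.trans e1'.symm)

/-- A colouring that changes only along circles, except at the crossings in `B`, is constant along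
the side of `a` that does not contain these crossings. -/
theorem IsParallel.exists_outer {B : Finset D.Crossing} {a b : Circle D.stateA}
    (hB : IsParallel B a b) {φ : D.HalfEdge → ZMod 2} (h1 : ∀ h, φ (D.rot (D.edge h)) = φ h)
    (h2 : ∀ x, x ∉ B → φ (x, 2) = φ (x, 0)) :
    ∃ κ, ∀ x ∈ B, (circleOf D.stateA (x, 0) = a → φ (x, 1) = κ) ∧
      (circleOf D.stateA (x, 2) = a → φ (x, 3) = κ) := by
  obtain ⟨ψ, p1, p2, p3⟩ := exists_coloring_indicator a
  obtain ⟨τ, hτ⟩ := hB.exists_side p1 p2 p3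
  -- `ψ + τ` vanishes on the side of `a` that contains the crossings in `B`
  have hmem : (fun h => φ h * (ψ h + τ) + φ (D.rot h) * (ψ (D.rot h) + τ)) ∈
      circleSpace D.stateA :=
    coboundary_mem (φ := fun h => φ h * (ψ h + τ)) (fun h => by rw [h1, p1]) fun x => by
      by_cases hx : x ∈ B
      · rw [p2, hτ x hx, CharTwo.add_self_eq_zero, mul_zero, mul_zero]
      · rw [p2, h2 x hx]
  have key0 : ∀ x ∈ B, circleOf D.stateA (x, 0) = a →
      φ (x, 0) * (ψ (x, 0) + τ) + φ (x, 1) * (ψ (x, 1) + τ) = φ (x, 1) := fun x hx hh => by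
    have e1 : _ = ψ (x, 0) + ψ (x, 1) := p3 (x, 0)
    rw [indicator_of_eq hh] at e1
    have := hτ x hx
    grind
  have key2 : ∀ x ∈ B, circleOf D.stateA (x, 2) = a →
      φ (x, 2) * (ψ (x, 2) + τ) + φ (x, 3) * (ψ (x, 3) + τ) = φ (x, 3) := fun x hx hh => by
    have e1 : _ = ψ (x, 2) + ψ (x, 3) := p3 (x, 2)
    rw [indicator_of_eq hh] at e1
    have := hτ x hx
    have := p2 x
    grind
  by_cases ha : ∃ h, circleOf D.stateA h = a
  · obtain ⟨h₀, hh₀⟩ := ha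
    refine ⟨φ h₀ * (ψ h₀ + τ) + φ (D.rot h₀) * (ψ (D.rot h₀) + τ), fun x hx => ⟨fun hh => ?_,
      fun hh => ?_⟩⟩
    · rw [← key0 x hx hh]
      exact eq_of_circleOf_eq hmem (hh.trans hh₀.symm)
    · rw [← key2 x hx hh]
      exact eq_of_circleOf_eq hmem (hh.trans hh₀.symm)
  · exact ⟨0, fun x hx => ⟨fun hh => absurd ⟨_, hh⟩ ha, fun hh => absurd ⟨_, hh⟩ ha⟩⟩

/-- If the `B`-labelled crossings are parallel, then the number of circles falls short of that bound
by at most two: the first merges the two circles, and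
each of the others splits off a circle. The functions constant on the circles of both states have
codimension one in those for the state with all labels `A`. They are the kernel of the map that
compares the values on the two sides of the crossings in `B`, and by duality the range of that map
is orthogonal to constant functions only. -/
theorem IsParallel.le_circleRank_stateOf {B : Finset D.Crossing} {a b : Circle D.stateA}
    (hB : IsParallel B a b) (hne : B.Nonempty) :
    circleRank D.stateA + B.card ≤ circleRank (stateOf B) + 2 := by
  classical
  obtain ⟨x₀, hx₀⟩ := hne
  let δ : circleSpace (stateOf B) →ₗ[ZMod 2] B → ZMod 2 :=
    { toFun := fun z x => z.1 (x.1, 0) + z.1 (x.1, 1)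
      map_add' := fun z z' => funext fun x => add_add_add_comm _ _ _ _
      map_smul' := fun c z => funext fun x => (mul_add c (z.1 (x.1, 0)) _).symm }
  have hδ := LinearMap.finrank_range_add_finrank_ker δ
  have hker : circleRank D.stateA ≤ Module.finrank (ZMod 2) (LinearMap.ker δ) + 1 := by
    rw [← Submodule.finrank_map_subtype_eq]
    let f : (D.HalfEdge → ZMod 2) →ₗ[ZMod 2] ZMod 2 :=
      LinearMap.proj (R := ZMod 2) (φ := fun _ : D.HalfEdge => ZMod 2) (x₀, 0) +
        LinearMap.proj (x₀, 2)
    refine finrank_le_finrank_add_one f fun z hz hf => ?_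
    have hf' : z (x₀, 0) = z (x₀, 2) := CharTwo.add_eq_zero.mp hf
    have hx : ∀ x ∈ B, z (x, 0) = z (x, 1) ∧ z (x, 0) = z (x, 2) ∧ z (x, 0) = z (x, 3) := by
      intro x hx
      obtain ⟨h1, h2⟩ := smooth_invariant_A (mem_circleSpace.mp hz).2 (x := x) rfl
      have : z (x, 0) = z (x, 2) := by
        rcases hB.ends x hx with ⟨e0, e2⟩ | ⟨e0, e2⟩ <;>
          rcases hB.ends x₀ hx₀ with ⟨e0', e2'⟩ | ⟨e0', e2'⟩
        · rw [eq_of_circleOf_eq hz (e0.trans e0'.symm), hf',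
            eq_of_circleOf_eq hz (e2'.trans e2.symm)]
        · rw [eq_of_circleOf_eq hz (e0.trans e2'.symm), ← hf',
            eq_of_circleOf_eq hz (e0'.trans e2.symm)]
        · rw [eq_of_circleOf_eq hz (e0.trans e2'.symm), ← hf',
            eq_of_circleOf_eq hz (e0'.trans e2.symm)]
        · rw [eq_of_circleOf_eq hz (e0.trans e0'.symm), hf',
            eq_of_circleOf_eq hz (e2'.trans e2.symm)]
      exact ⟨h1, this, this.trans h2⟩
    refine ⟨⟨z, mem_circleSpace_of_eq_off hz fun x h => hx x ?_⟩, ?_, rfl⟩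
    · by_contra hxB
      exact h (stateOf_of_notMem hxB).symm
    · refine LinearMap.mem_ker.mpr (funext fun x => ?_)
      change z (x.1, 0) + z (x.1, 1) = 0
      rw [(hx x.1 x.2).1, CharTwo.add_self_eq_zero]
  have hrange : Fintype.card B ≤ Module.finrank (ZMod 2) (LinearMap.range δ) +
      Module.finrank (ZMod 2) (Submodule.span (ZMod 2) {(1 : B → ZMod 2)}) := by
    refine card_le_finrank_range_add δ fun α hα => ?_
    let α' : D.Crossing → ZMod 2 := fun x => if h : x ∈ B then α ⟨x, h⟩ else 0
    have hα' : ∀ x ∉ B, α' x = 0 := fun x h => dif_neg h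
    let w : D.HalfEdge → ZMod 2 := fun h => if h.2 = 0 ∨ h.2 = 1 then α' h.1 else 0
    have w0 : ∀ x, w (x, 0) = α' x := fun x => rfl
    have w1 : ∀ x, w (x, 1) = α' x := fun x => rfl
    have w2 : ∀ x, w (x, 2) = 0 := fun x => rfl
    have w3 : ∀ x, w (x, 3) = 0 := fun x => rfl
    obtain ⟨u, v, hu, hv, huv⟩ := exists_add_of_orthogonal (w := w) D.edge_edge D.edge_ne
        (smooth_smooth (stateOf B)) (smooth_ne (stateOf B)) fun z z1 z2 => by
      rw [← hα ⟨z, mem_circleSpace.mpr ⟨z1, z2⟩⟩, Fintype.sum_prod_type,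
        ← Finset.sum_subset (Finset.subset_univ B), ← Finset.sum_coe_sort B]
      · refine Finset.sum_congr rfl fun x _ => ?_
        rw [Fin.sum_univ_four, w0, w1, w2, w3]
        have : α' x = α x := dif_pos x.2
        rw [this]
        change _ = (z (x.1, 0) + z (x.1, 1)) * α x
        ring
      · intro x _ hx
        rw [Fin.sum_univ_four, w0, w1, w2, w3, hα' x hx]
        ring
    have hw : ∀ h, w h = u h + v h := fun h => congrFun huv h
    have hcyc : ∀ x, ∑ i, u (x, i) = 0 := fun x => by
      have e0 := hw (x, 0)
      have e1 := hw (x, 1)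
      have e2 := hw (x, 2)
      have e3 := hw (x, 3)
      rw [w0] at e0
      rw [w1] at e1
      rw [w2] at e2
      rw [w3] at e3
      rw [Fin.sum_univ_four]
      by_cases hx : x ∈ B
      · obtain ⟨f1, f2⟩ := smooth_invariant_B hv (stateOf_of_mem hx)
        grind
      · obtain ⟨f1, f2⟩ := smooth_invariant_A hv (stateOf_of_notMem hx)
        grind
    obtain ⟨φ, hφ, hφu⟩ := D.exists_coloring D.planar hu hcyc
    have p0 : ∀ x, u (x, 0) = φ (x, 0) + φ (x, 1) := fun x => hφu (x, 0)
    have p1 : ∀ x, u (x, 1) = φ (x, 1) + φ (x, 2) := fun x => hφu (x, 1)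
    have p3 : ∀ x, u (x, 3) = φ (x, 3) + φ (x, 0) := fun x => hφu (x, 3)
    have hφB : ∀ x, x ∉ B → φ (x, 2) = φ (x, 0) := fun x hx => by
      obtain ⟨f1, f2⟩ := smooth_invariant_A hv (stateOf_of_notMem hx)
      have e0 := hw (x, 0)
      have e1 := hw (x, 1)
      have := p0 x
      have := p1 x
      rw [w0, hα' x hx] at e0
      rw [w1, hα' x hx] at e1
      grind
    obtain ⟨κ, hκ⟩ := hB.exists_outer hφ hφB
    obtain ⟨μ, hμ⟩ := hB.symm.exists_outer hφ hφB
    refine Submodule.mem_span_singleton.mpr ⟨κ + μ, funext fun x => ?_⟩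
    rw [Pi.smul_apply, Pi.one_apply, smul_eq_mul, mul_one]
    have hx : α x = φ (x.1, 1) + φ (x.1, 3) := by
      obtain ⟨f1, f2⟩ := smooth_invariant_B hv (stateOf_of_mem x.2)
      have e0 := hw (x.1, 0)
      have e3 := hw (x.1, 3)
      have := p0 x.1
      have := p3 x.1
      have hx' : α' x = α x := dif_pos x.2
      rw [w0, hx'] at e0
      rw [w3] at e3
      grind
    rw [hx]
    rcases hB.ends x.1 x.2 with ⟨e0, e2⟩ | ⟨e0, e2⟩
    · rw [(hκ x.1 x.2).1 e0, (hμ x.1 x.2).2 e2]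
    · rw [(hμ x.1 x.2).1 e0, (hκ x.1 x.2).2 e2, add_comm]
  have hspan : Module.finrank (ZMod 2) (Submodule.span (ZMod 2) {(1 : B → ZMod 2)}) ≤ 1 :=
    (finrank_span_le_card _).trans (by simp)
  rw [Fintype.card_coe] at hrange
  unfold circleRank at *
  omega

end LinkDiagram

/-! ### The enhanced states of almost-extreme degree -/

/-- The simplices of the partial presimplicial set of a graph, shifted so that they are indexed by
their number of vertices. In degree `m = k + 1` this is the set `X_k`; in degree `0` it contains
the empty tuple if all edges join the same pair of vertices, and the vertices of the graph if there
is no edge. -/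
def AugObj {V : Type} {c : ℕ} (ends : Fin c → Sym2 V) (m : ℕ) : Type :=
  {_T : V // m = c} ⊕
    {w : Fin m ↪o Fin c // m < c ∧
      ∀ x y, x ∉ Set.range w → y ∉ Set.range w → ends x = ends y}

namespace LinkDiagram

variable {D : LinkDiagram}

/-- The number of negative circles. -/
noncomputable def negCount (S : D.EnhancedState) : ℕ :=
  (Finset.univ.filter fun a => S.2 a = -1).card

theorem tau_eq (S : D.EnhancedState) :
    tau S = circleRank S.1 + D.numLoops - 2 * negCount S := by
  have h : ∀ a, (S.2 a : ℤ) = 1 - 2 * if S.2 a = -1 then 1 else 0 := fun a => by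
    rcases Int.units_eq_one_or (S.2 a) with h | h <;> rw [h] <;> decide
  rw [tau, Finset.sum_congr rfl fun a _ => h a, Finset.sum_sub_distrib, ← Finset.mul_sum,
    Finset.sum_boole, Finset.sum_const, Finset.card_univ, card_circle, negCount]
  simp

theorem negCount_eq_zero_of_one {s : D.State} :
    negCount (⟨s, fun _ => 1⟩ : D.EnhancedState) = 0 := by
  rw [negCount, Finset.card_eq_zero, Finset.filter_eq_empty_iff]
  exact fun _ _ => show (1 : ℤˣ) ≠ -1 by decide

open Classical in
theorem negCount_single {s : D.State} (T : Circle s) :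
    negCount (⟨s, fun a => if a = T then -1 else 1⟩ : D.EnhancedState) = 1 := by
  rw [negCount, Finset.card_eq_one]
  refine ⟨T, Finset.ext fun a => ?_⟩
  rw [Finset.mem_filter, Finset.mem_singleton]
  dsimp only
  split_ifs with h
  · simp [h]
  · simp only [h, iff_false, not_and]
    exact fun _ => by decide

/-- The set of the `B`-labelled crossings. -/
def labelB (s : D.State) : Finset D.Crossing := Finset.univ.filter fun x => s x = .B

theorem stateOf_labelB (s : D.State) : stateOf (labelB s) = s := by
  funext x
  simp only [stateOf, labelB, Finset.mem_filter, Finset.mem_univ, true_and]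
  cases s x <;> simp

theorem labelB_stateOf (B : Finset D.Crossing) : labelB (stateOf B) = B := by
  ext x
  simp [labelB, stateOf]

theorem stateOf_injective : Function.Injective (stateOf : Finset D.Crossing → D.State) :=
  Function.LeftInverse.injective labelB_stateOf

theorem iDeg_eq (S : D.EnhancedState) : iDeg S = D.numCrossings - 2 * (labelB S.1).card := by
  have h := Finset.card_filter_add_card_filter_not (s := Finset.univ) fun x => S.1 x = .A
  have h' : (Finset.univ.filter fun x => ¬ S.1 x = .A) = labelB S.1 := by
    refine Finset.filter_congr fun x _ => ?_
    cases S.1 x <;> simp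
  rw [h', Finset.card_univ, Fintype.card_fin] at h
  change ((Finset.univ.filter fun x => S.1 x = .A).card : ℤ) - (labelB S.1).card = _
  omega

theorem jDeg_eq (S : D.EnhancedState) : jDeg S = D.numCrossings - 2 * (labelB S.1).card +
    2 * (circleRank S.1 + D.numLoops - 2 * negCount S) := by
  rw [jDeg, iDeg_eq, tau_eq]

theorem circleRank_le (s : D.State) :
    circleRank s ≤ circleRank D.stateA + (labelB s).card := by
  have h := circleRank_stateOf_le_of_subset (Finset.empty_subset (labelB s))
  rwa [stateOf_labelB, stateOf_empty, Finset.card_empty, add_zero] at h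

theorem labelB_stateA : labelB D.stateA = ∅ := by
  rw [← stateOf_empty, labelB_stateOf]

theorem jMax_eq : D.jMax = D.numCrossings + 2 * (circleRank D.stateA + D.numLoops) := by
  refine IsGreatest.csSup_eq ⟨⟨⟨D.stateA, fun _ => 1⟩, ?_⟩, ?_⟩
  · rw [jDeg_eq, negCount_eq_zero_of_one, labelB_stateA, Finset.card_empty]
    ring
  · rintro _ ⟨S, rfl⟩
    have := circleRank_le S.1
    rw [jDeg_eq]
    omega

theorem jAlmax_eq : D.jAlmax = D.numCrossings + 2 * (circleRank D.stateA + D.numLoops) - 4 := by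
  rw [jAlmax, jMax_eq]

/-- The crossings that are not in a tuple. -/
def compl {c m : ℕ} (w : Fin m ↪o Fin c) : Finset (Fin c) :=
  (Finset.univ.map w.toEmbedding)ᶜ

theorem mem_compl {c m : ℕ} {w : Fin m ↪o Fin c} {x : Fin c} :
    x ∈ compl w ↔ x ∉ Set.range w := by
  simp [compl]

theorem card_compl {c m : ℕ} (w : Fin m ↪o Fin c) : (compl w).card + m = c := by
  have h := Finset.card_compl_add_card (Finset.univ.map w.toEmbedding)
  rwa [Finset.card_map, Finset.card_univ, Fintype.card_fin, Fintype.card_fin] at h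

theorem compl_injective {c m : ℕ} :
    Function.Injective (compl : (Fin m ↪o Fin c) → Finset (Fin c)) := fun w w' h => by
  refine OrderEmbedding.range_inj.mp (Set.ext fun x => not_iff_not.mp ?_)
  rw [← mem_compl, h, mem_compl]

open Classical in
/-- The enhanced state that corresponds to a simplex: to a vertex `T` of the graph, the state with
all labels `A` in which just the circle `T` is negative; to a tuple of edges, the state with
`A`-labels at these edges in which all circles are positive. -/
noncomputable def enhancedState {m : ℕ} : AugObj (stateGraph D.stateA) m → D.EnhancedState
  | Sum.inl T => ⟨D.stateA, fun a => if a = T.1 then -1 else 1⟩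
  | Sum.inr w => ⟨stateOf (compl w.1), fun _ => 1⟩

theorem card_labelB_enhancedState {m : ℕ} (a : AugObj (stateGraph D.stateA) m) :
    (labelB (enhancedState a).1).card + m = D.numCrossings := by
  rcases a with T | w
  · rw [show (enhancedState (D := D) (m := m) (Sum.inl T)).1 = D.stateA from rfl, labelB_stateA,
      Finset.card_empty, T.2, zero_add]
  · rw [show (enhancedState (D := D) (m := m) (Sum.inr w)).1 = stateOf (compl w.1) from rfl,
      labelB_stateOf, card_compl]

theorem iDeg_enhancedState {m : ℕ} (a : AugObj (stateGraph D.stateA) m) :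
    iDeg (enhancedState a) = 2 * m - D.numCrossings := by
  have := card_labelB_enhancedState a
  rw [iDeg_eq]
  omega

theorem isParallel_of_stateGraph_eq (hA : D.IsAAdequate) {B : Finset D.Crossing} {x : D.Crossing}
    (h : ∀ y ∈ B, stateGraph D.stateA y = stateGraph D.stateA x) :
    IsParallel B (circleOf D.stateA (x, 0)) (circleOf D.stateA (x, 2)) :=
  ⟨circleOf_ne hA x, fun y hy => Sym2.eq_iff.mp (h y hy)⟩

theorem jDeg_enhancedState (hA : D.IsAAdequate) {m : ℕ} (a : AugObj (stateGraph D.stateA) m) :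
    jDeg (enhancedState a) = D.jAlmax := by
  rw [jDeg_eq, jAlmax_eq]
  rcases a with T | ⟨w, hm, hw⟩
  · simp only [enhancedState, negCount_single, labelB_stateA, Finset.card_empty]
    ring
  · obtain ⟨x, hx⟩ : (compl w).Nonempty := by
      have := card_compl w
      rw [← Finset.card_pos]
      omega
    have h1 := (isParallel_of_stateGraph_eq hA (B := compl w) (x := x) fun y hy =>
      hw y x (mem_compl.mp hy) (mem_compl.mp hx)).le_circleRank_stateOf ⟨x, hx⟩
    have h2 := circleRank_stateOf_le hA ⟨x, hx⟩
    simp only [enhancedState, negCount_eq_zero_of_one, labelB_stateOf]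
    omega

theorem enhancedState_injective {m : ℕ} :
    Function.Injective (enhancedState : AugObj (stateGraph D.stateA) m → D.EnhancedState) := by
  rintro (⟨T, hT⟩ | ⟨w, hw⟩) (⟨T', hT'⟩ | ⟨w', hw'⟩) h
  · simp only [enhancedState, Sigma.mk.injEq, heq_eq_eq, true_and] at h
    have := congrFun h T
    rw [if_pos rfl] at this
    by_cases e : T = T'
    · subst e
      rfl
    · rw [if_neg e] at this
      exact absurd this (by decide)
  · exact absurd hT hw'.1.ne
  · exact absurd hT' hw.1.ne
  · have := compl_injective (stateOf_injective (congrArg Sigma.fst h))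
    subst this
    rfl

/-- Every enhanced state of almost-extreme degree is given by a simplex. -/
theorem exists_enhancedState_eq (hA : D.IsAAdequate) {m : ℕ} {S : D.EnhancedState}
    (hi : iDeg S = 2 * m - D.numCrossings) (hj : jDeg S = D.jAlmax) :
    ∃ a : AugObj (stateGraph D.stateA) m, enhancedState a = S := by
  rw [iDeg_eq] at hi
  rw [jDeg_eq, jAlmax_eq] at hj
  obtain ⟨s, ε⟩ := S
  dsimp only at hi hj
  generalize hB : labelB s = B at hi hj
  obtain rfl : s = stateOf B := by rw [← hB, stateOf_labelB]
  rcases B.eq_empty_or_nonempty with rfl | hne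
  · have hs : ∀ (s : D.State) (ε : Circle s → ℤˣ), s = D.stateA → negCount ⟨s, ε⟩ = 1 →
        ∃ a : AugObj (stateGraph D.stateA) m, enhancedState a = ⟨s, ε⟩ := by
      rintro s ε rfl h1
      obtain ⟨T, hT⟩ := Finset.card_eq_one.mp h1
      refine ⟨Sum.inl ⟨T, by rw [Finset.card_empty] at hi; omega⟩, ?_⟩
      simp only [enhancedState, Sigma.mk.injEq, heq_eq_eq, true_and]
      funext a
      have := Finset.ext_iff.mp hT a
      simp only [Finset.mem_filter, Finset.mem_univ, true_and, Finset.mem_singleton] at this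
      split_ifs with e
      · exact (this.mpr e).symm
      · exact ((Int.units_eq_one_or _).resolve_right fun h => e (this.mp h)).symm
    refine hs _ ε stateOf_empty ?_
    have h1 : circleRank (stateOf (D := D) ∅) = circleRank D.stateA := by rw [stateOf_empty]
    rw [Finset.card_empty] at hj
    omega
  · have h1 := circleRank_stateOf_le hA hne
    have h0 : negCount (⟨stateOf B, ε⟩ : D.EnhancedState) = 0 := by omega
    have hc : B.card ≤ D.numCrossings := by simpa using Finset.card_le_univ B
    have hpos := Finset.card_pos.mpr hne
    have hcm : Bᶜ.card = m := by
      rw [Finset.card_compl, Fintype.card_fin]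
      omega
    obtain ⟨w, rfl⟩ : ∃ w : Fin m ↪o D.Crossing, B = compl w := by
      refine ⟨Bᶜ.orderEmbOfFin hcm, Finset.ext fun x => ?_⟩
      rw [mem_compl, Finset.range_orderEmbOfFin, Finset.mem_coe, Finset.mem_compl, not_not]
    refine ⟨Sum.inr ⟨w, by have := card_compl w; omega, fun x y hx hy => ?_⟩, ?_⟩
    · by_contra hxy
      have := circleRank_stateOf_lt hA (mem_compl.mpr hx) (mem_compl.mpr hy) hxy
      omega
    · simp only [enhancedState, Sigma.mk.injEq, heq_eq_eq, true_and]
      funext a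
      rw [negCount, Finset.card_eq_zero, Finset.filter_eq_empty_iff] at h0
      exact ((Int.units_eq_one_or _).resolve_right (h0 (Finset.mem_univ a))).symm

/-- The generators of the almost-extreme complex in degree `m` are the simplices with `m`
vertices. -/
noncomputable def generatorEquiv (hA : D.IsAAdequate) (m : ℕ) :
    AugObj (stateGraph D.stateA) m ≃ D.Generator (2 * m - D.numCrossings) D.jAlmax :=
  Equiv.ofBijective (fun a => ⟨enhancedState a, iDeg_enhancedState a, jDeg_enhancedState hA a⟩)
    ⟨fun _ _ h => enhancedState_injective (congrArg Subtype.val h), fun S => by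
      obtain ⟨a, ha⟩ := exists_enhancedState_eq hA S.2.1 S.2.2
      exact ⟨a, Subtype.ext ha⟩⟩

theorem generatorEquiv_val (hA : D.IsAAdequate) {m : ℕ} (a : AugObj (stateGraph D.stateA) m) :
    (generatorEquiv hA m a).1 = enhancedState a := rfl

end LinkDiagram

/-! ### The differential of the almost-extreme complex -/

namespace AugObj

variable {V : Type} {c : ℕ} {ends : Fin c → Sym2 V}

/-- The edges of a simplex; those of a vertex of the graph are all edges. -/
def edges {m : ℕ} : AugObj ends m → (Fin m ↪o Fin c)
  | Sum.inl T => (Fin.castOrderIso T.2).toOrderEmbedding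
  | Sum.inr w => w.1

/-- The tuple without its `i`-th entry. -/
def omitEntry {m : ℕ} (w : Fin (m + 1) ↪o Fin c) (i : Fin (m + 1)) : Fin m ↪o Fin c :=
  (Fin.succAboveOrderEmb i).trans w

theorem notMem_range_omitEntry {m : ℕ} {w : Fin (m + 1) ↪o Fin c} {i : Fin (m + 1)} {x : Fin c} :
    x ∉ Set.range (omitEntry w i) ↔ x = w i ∨ x ∉ Set.range w := by
  constructor
  · intro h
    by_contra! h'
    obtain ⟨h1, l, rfl⟩ := h'
    obtain ⟨k, rfl⟩ := Fin.exists_succAbove_eq (x := l) (y := i) fun e => h1 (by rw [e])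
    exact h ⟨k, rfl⟩
  · rintro (rfl | h) ⟨k, hk⟩
    · exact Fin.succAbove_ne i k (w.injective hk)
    · exact h ⟨_, hk⟩

theorem lt_of_orderEmbedding {m : ℕ} (w : Fin (m + 1) ↪o Fin c) : m < c := by
  simpa using Fintype.card_le_of_injective w w.injective

/-- The face maps of the partial presimplicial set of a graph, extended to the face maps
from tuples with one entry to the empty tuple. -/
def face {m : ℕ} (i : Fin (m + 1)) : AugObj ends (m + 1) →. AugObj ends m
  | Sum.inl T =>
    { Dom := T.1 ∈ ends (Fin.castOrderIso T.2 i)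
      get := fun _ => Sum.inr ⟨omitEntry (Fin.castOrderIso T.2).toOrderEmbedding i,
        lt_of_orderEmbedding (Fin.castOrderIso T.2).toOrderEmbedding, fun x y hx hy => by
          have h : ∀ z, z ∈ Set.range (Fin.castOrderIso T.2).toOrderEmbedding :=
            (Fin.castOrderIso T.2).surjective
          rw [(notMem_range_omitEntry.mp hx).resolve_right fun h' => h' (h x),
            (notMem_range_omitEntry.mp hy).resolve_right fun h' => h' (h y)]⟩ }
  | Sum.inr w =>
    { Dom := ∀ y, y ∉ Set.range w.1 → ends (w.1 i) = ends y
      get := fun h => Sum.inr ⟨omitEntry w.1 i, lt_of_orderEmbedding w.1, fun x y hx hy => by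
        rcases notMem_range_omitEntry.mp hx with rfl | hx <;>
          rcases notMem_range_omitEntry.mp hy with rfl | hy
        · rfl
        · exact h _ hy
        · exact (h _ hx).symm
        · exact w.2.2 x y hx hy⟩ }

theorem graphPresimplicialSet_d (k : ℕ) (i : Fin (k + 2)) (a : AugObj ends (k + 2)) :
    (graphPresimplicialSet ends).d k i a = face i a := by
  rcases a with T | w <;> rfl

theorem edges_of_mem_face {m : ℕ} {i : Fin (m + 1)} {a : AugObj ends (m + 1)} {a' : AugObj ends m}
    (h : a' ∈ face i a) : a'.edges = omitEntry a.edges i := by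
  obtain ⟨h', rfl⟩ := h
  rcases a with T | w <;> rfl

/-- The sign by which the basis vector of a simplex has to be changed in order that the signs of
the Khovanov differential become those of the simplicial boundary map. -/
def sign {m : ℕ} (w : Fin m ↪o Fin c) : ℤˣ := (-1) ^ ∑ j, (c + 1 + (w j : ℕ) + j)

theorem card_filter_compl {m : ℕ} (w : Fin (m + 1) ↪o Fin c) (i : Fin (m + 1)) :
    (Finset.univ.filter fun y => w i < y ∧ y ∉ Set.range w).card + (m + w i + 1) = c + i := by
  have h1 : (Finset.univ.filter fun y => w i < y ∧ y ∉ Set.range w) =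
      Finset.Ioi (w i) \ (Finset.Ioi i).map w.toEmbedding := by
    ext y
    simp only [Finset.mem_filter, Finset.mem_univ, true_and, Finset.mem_sdiff, Finset.mem_Ioi,
      Finset.mem_map, RelEmbedding.coe_toEmbedding, Set.mem_range]
    refine and_congr_right fun hy => not_congr ⟨?_, ?_⟩
    · rintro ⟨l, rfl⟩
      exact ⟨l, w.lt_iff_lt.mp hy, rfl⟩
    · rintro ⟨l, -, rfl⟩
      exact ⟨l, rfl⟩
  have h2 : (Finset.Ioi i).map w.toEmbedding ⊆ Finset.Ioi (w i) := by
    intro y hy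
    obtain ⟨l, hl, rfl⟩ := Finset.mem_map.mp hy
    exact Finset.mem_Ioi.mpr (w.lt_iff_lt.mpr (Finset.mem_Ioi.mp hl))
  have h3 := Finset.card_le_card h2
  rw [h1, Finset.card_sdiff_of_subset h2]
  rw [Finset.card_map, Fin.card_Ioi, Fin.card_Ioi] at h3 ⊢
  have := (w i).2
  have := i.2
  omega

theorem sign_mul {m : ℕ} (w : Fin (m + 1) ↪o Fin c) (i : Fin (m + 1)) :
    (sign w : ℤ) * (-1) ^ (Finset.univ.filter fun y => w i < y ∧ y ∉ Set.range w).card =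
      (-1) ^ (i : ℕ) * sign (omitEntry w i) := by
  have h1 : ∑ j, (c + 1 + (w j : ℕ) + j) =
      ∑ j, (c + 1 + (omitEntry w i j : ℕ) + j) + (c + 1 + w i + m) := by
    simp only [Finset.sum_add_distrib, Finset.sum_const, Finset.card_univ, Fintype.card_fin]
    rw [Fin.sum_univ_succAbove (fun j => (w j : ℕ)) i, Fin.sum_univ_castSucc fun j => (j : ℕ)]
    simp only [Fin.val_castSucc, Fin.val_last, smul_eq_mul]
    change _ = (m * c + m * 1 + ∑ j, (w (i.succAbove j) : ℕ) + ∑ j : Fin m, (j : ℕ)) + _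
    ring
  have h2 := card_filter_compl w i
  simp only [sign, Units.val_pow_eq_pow_val, Units.val_neg, Units.val_one, ← pow_add]
  rw [h1, neg_one_pow_congr]
  generalize (Finset.univ.filter fun y => w i < y ∧ y ∉ Set.range w).card = k at *
  generalize ∑ j, (c + 1 + (omitEntry w i j : ℕ) + j) = l at *
  grind

end AugObj

namespace LinkDiagram

variable {D : LinkDiagram}

theorem label_enhancedState {m : ℕ} (a : AugObj (stateGraph D.stateA) m) (x : D.Crossing) :
    (enhancedState a).1 x = if x ∈ Set.range a.edges then .A else .B := by
  rcases a with T | w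
  · rw [if_pos]
    · rfl
    · exact (Fin.castOrderIso T.2).surjective x
  · by_cases h : x ∈ Set.range w.1
    · exact (stateOf_of_notMem fun h' => mem_compl.mp h' h).trans (if_pos h).symm
    · exact (stateOf_of_mem (mem_compl.mpr h)).trans (if_neg h).symm

theorem label_enhancedState_eq_A {m : ℕ} (a : AugObj (stateGraph D.stateA) m) (x : D.Crossing) :
    (enhancedState a).1 x = .A ↔ x ∈ Set.range a.edges := by
  rw [label_enhancedState]
  split_ifs with h <;> simp [h]

theorem label_enhancedState_eq_B {m : ℕ} (a : AugObj (stateGraph D.stateA) m) (x : D.Crossing) :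
    (enhancedState a).1 x = .B ↔ x ∉ Set.range a.edges := by
  rw [label_enhancedState]
  split_ifs with h <;> simp [h]

theorem circleOf_mem_stateGraph (x : D.Crossing) (p : Fin 4) :
    circleOf D.stateA (x, p) ∈ stateGraph D.stateA x := by
  have h1 : circleOf D.stateA (x, 1) = circleOf D.stateA (x, 0) := circleOf_smooth _ (x, 0)
  have h3 : circleOf D.stateA (x, 3) = circleOf D.stateA (x, 2) := circleOf_smooth _ (x, 2)
  fin_cases p
  · exact Sym2.mem_mk_left _ _
  · exact h1 ▸ Sym2.mem_mk_left _ _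
  · exact Sym2.mem_mk_right _ _
  · exact h3 ▸ Sym2.mem_mk_right _ _

/-- If just the circle `T` is negative, then all circles that do not touch the crossing `x` are
positive exactly if `T` touches `x`. -/
theorem forall_eq_one_iff_mem_stateGraph {T : Circle D.stateA} {ε : Circle D.stateA → ℤˣ}
    (hε : ∀ a, ε a = 1 ↔ a ≠ T) (x : D.Crossing) :
    ((∀ h : D.HalfEdge, (∀ p, circleOf D.stateA h ≠ circleOf D.stateA (x, p)) →
      1 = ε (circleOf D.stateA h)) ∧ ∀ k, 1 = ε (loopCircle D.stateA k)) ↔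
      T ∈ stateGraph D.stateA x := by
  constructor
  · rintro ⟨h1, h2⟩
    rcases T with q | k
    · obtain ⟨h, rfl⟩ := Quot.exists_rep q
      by_contra hx
      refine (hε _).mp (h1 h fun p hp => hx ?_).symm rfl
      change circleOf D.stateA h ∈ _
      rw [hp]
      exact circleOf_mem_stateGraph x p
    · exact absurd rfl ((hε _).mp (h2 k).symm)
  · intro hT
    obtain ⟨p, rfl⟩ : ∃ p, T = circleOf D.stateA (x, p) := by
      rcases Sym2.mem_iff.mp hT with h | h
      exacts [⟨_, h⟩, ⟨_, h⟩]
    exact ⟨fun h hh => ((hε _).mpr (hh p)).symm, fun k => ((hε _).mpr Sum.inr_ne_inl).symm⟩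

open Classical in
theorem ite_eq_one_iff {T : Circle D.stateA} (a : Circle D.stateA) :
    (if a = T then -1 else 1 : ℤˣ) = 1 ↔ a ≠ T := by
  split_ifs with h
  · simp only [h, ne_eq, not_true_eq_false, iff_false]
    decide
  · simp [h]

/-- Adjacency of enhanced states of almost-extreme degree is the face relation. -/
theorem adjacentAt_iff (hA : D.IsAAdequate) {m : ℕ} (a : AugObj (stateGraph D.stateA) (m + 1))
    (a' : AugObj (stateGraph D.stateA) m) (i : Fin (m + 1)) :
    AdjacentAt (enhancedState a) (enhancedState a') (a.edges i) ↔ a' ∈ AugObj.face i a := by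
  constructor
  · intro h
    have hlt := AugObj.lt_of_orderEmbedding a.edges
    rcases a' with T' | w'
    · exact absurd T'.2 hlt.ne
    have hw' : w'.1 = AugObj.omitEntry a.edges i := by
      refine OrderEmbedding.range_inj.mp (Set.ext fun y => not_iff_not.mp ?_)
      have e := label_enhancedState_eq_B (D := D) (m := m) (Sum.inr w') y
      rw [show AugObj.edges (ends := stateGraph D.stateA) (Sum.inr w') = w'.1 from rfl] at e
      rw [AugObj.notMem_range_omitEntry, ← e]
      by_cases hy : y = a.edges i
      · rw [hy]
        exact ⟨fun _ => Or.inl rfl, fun _ => h.label_right⟩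
      · rw [h.label_eq y hy, label_enhancedState_eq_B]
        exact ⟨Or.inr, fun h' => h'.resolve_left hy⟩
    obtain ⟨w', hm, hp⟩ := w'
    dsimp only at hw'
    subst hw'
    rcases a with T | w
    · exact ⟨(forall_eq_one_iff_mem_stateGraph ite_eq_one_iff _).mp
        ⟨h.sign_eq, h.sign_loop_eq⟩, rfl⟩
    · exact ⟨fun y hy => hp _ _ (AugObj.notMem_range_omitEntry.mpr (Or.inl rfl))
        (AugObj.notMem_range_omitEntry.mpr (Or.inr hy)), rfl⟩
  · intro h
    have he := AugObj.edges_of_mem_face h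
    refine ⟨?_, ?_, ?_, ?_, ?_, ?_, ?_⟩
    · rw [iDeg_enhancedState, iDeg_enhancedState]
      push_cast
      ring
    · rw [jDeg_enhancedState hA, jDeg_enhancedState hA]
    · exact (label_enhancedState_eq_A _ _).mpr ⟨i, rfl⟩
    · rw [label_enhancedState_eq_B, he, AugObj.notMem_range_omitEntry]
      exact Or.inl rfl
    · intro y hy
      have : y ∈ Set.range a'.edges ↔ y ∈ Set.range a.edges := by
        rw [← not_iff_not, he, AugObj.notMem_range_omitEntry]
        exact ⟨fun h' => h'.resolve_left hy, Or.inr⟩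
      rw [label_enhancedState, label_enhancedState]
      simp only [this]
    · obtain ⟨hd, rfl⟩ := h
      rcases a with T | w
      · exact ((forall_eq_one_iff_mem_stateGraph ite_eq_one_iff _).mpr hd).1
      · exact fun _ _ => rfl
    · obtain ⟨hd, rfl⟩ := h
      rcases a with T | w
      · exact ((forall_eq_one_iff_mem_stateGraph ite_eq_one_iff _).mpr hd).2
      · exact fun _ => rfl

open Classical in
theorem incidence_enhancedState (hA : D.IsAAdequate) {m : ℕ}
    (a : AugObj (stateGraph D.stateA) (m + 1)) (a' : AugObj (stateGraph D.stateA) m) :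
    incidence (enhancedState a) (enhancedState a') =
      ∑ i, if a' ∈ AugObj.face i a then
        (-1) ^ (Finset.univ.filter fun y => a.edges i < y ∧ y ∉ Set.range a.edges).card else 0 := by
  rw [incidence]
  refine (Fintype.sum_of_injective a.edges a.edges.injective _ _ (fun x hx => if_neg fun h => ?_)
    fun i => ?_).symm
  · exact hx ((label_enhancedState_eq_A _ _).mp h.label_left)
  · simp only [← adjacentAt_iff hA, label_enhancedState_eq_B]

/-- The basis of the almost-extreme complex given by the simplices, with signs. -/
noncomputable def generatorBasis (hA : D.IsAAdequate) (m : ℕ) :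
    Module.Basis (AugObj (stateGraph D.stateA) m) ℤ
      (D.Generator (2 * m - D.numCrossings) D.jAlmax →₀ ℤ) :=
  (Finsupp.basisSingleOne.reindex (generatorEquiv hA m).symm).unitsSMul
    fun a => AugObj.sign a.edges

theorem generatorBasis_apply (hA : D.IsAAdequate) {m : ℕ} (a : AugObj (stateGraph D.stateA) m) :
    generatorBasis hA m a =
      (AugObj.sign a.edges : ℤ) • Finsupp.single (generatorEquiv hA m a) 1 := by
  rw [generatorBasis, Module.Basis.unitsSMul_apply, Units.smul_def]
  simp

open Classical in
/-- In the basis of the simplices, the Khovanov differential is the alternating sum of the faces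
that are defined. -/
theorem khovanovD_generatorBasis (hA : D.IsAAdequate) {m : ℕ}
    (a : AugObj (stateGraph D.stateA) (m + 1)) :
    D.khovanovD (2 * (m + 1 : ℕ) - D.numCrossings) (2 * m - D.numCrossings) D.jAlmax
        (generatorBasis hA (m + 1) a) =
      ∑ i : Fin (m + 1), (-1 : ℤ) ^ (i : ℕ) •
        if h : (AugObj.face i a).Dom then generatorBasis hA m ((AugObj.face i a).get h) else 0 := by
  have : Fintype (AugObj (stateGraph D.stateA) m) := Fintype.ofEquiv _ (generatorEquiv hA m).symm
  rw [generatorBasis_apply, map_smul, khovanovD, Finsupp.linearCombination_single, one_smul,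
    ← Equiv.sum_comp (generatorEquiv hA m)]
  simp only [generatorEquiv_val, incidence_enhancedState hA, Finset.sum_smul]
  rw [Finset.sum_comm, Finset.smul_sum]
  refine Finset.sum_congr rfl fun i _ => ?_
  by_cases h : (AugObj.face i a).Dom
  · rw [dif_pos h, Fintype.sum_eq_single ((AugObj.face i a).get h) fun a' ha' => ?_,
      if_pos (Part.get_mem h), generatorBasis_apply, smul_smul, smul_smul, AugObj.sign_mul,
      AugObj.edges_of_mem_face (Part.get_mem h)]
    rw [if_neg fun h' => ha' (Part.get_eq_of_mem h' h).symm, zero_smul]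
  · rw [dif_neg h, smul_zero, Finset.sum_eq_zero, smul_zero]
    intro a' _
    rw [if_neg fun h' => h h'.1, zero_smul]

/-! ### The bottom degree -/

theorem numLoops_eq_zero (hD : D.IsConnected) (x : D.Crossing) : D.numLoops = 0 := by
  have : Finite D.Component := Quot.finite _
  have : Nonempty D.Component := ⟨Quot.mk _ (x, 0)⟩
  have := Nat.card_pos (α := D.Component)
  rw [IsConnected] at hD
  omega

theorem exists_mem_stateGraph (hD : D.IsConnected) (x : D.Crossing) (T : Circle D.stateA) :
    ∃ y, T ∈ stateGraph D.stateA y := by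
  rcases T with q | k
  · obtain ⟨⟨y, p⟩, rfl⟩ := Quot.exists_rep q
    exact ⟨y, circleOf_mem_stateGraph y p⟩
  · exact (Fin.cast (numLoops_eq_zero hD x) k).elim0

/-- If all edges of the graph join the same pair of vertices, then all faces are defined. -/
theorem face_dom (hD : D.IsConnected) (e : AugObj (stateGraph D.stateA) 0) {m : ℕ}
    (i : Fin (m + 1)) (a : AugObj (stateGraph D.stateA) (m + 1)) : (AugObj.face i a).Dom := by
  have hpar : ∀ x y, stateGraph D.stateA x = stateGraph D.stateA y := by
    rcases e with T | w
    · exact fun x => (Fin.cast T.2.symm x).elim0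
    · have hw : ∀ x, x ∉ Set.range w.1 := fun x ⟨j, _⟩ => j.elim0
      exact fun x y => w.2.2 x y (hw x) (hw y)
  rcases a with T | w
  · obtain ⟨y, hy⟩ := exists_mem_stateGraph hD (Fin.castOrderIso T.2 i) T.1
    change T.1 ∈ stateGraph D.stateA _
    rwa [← hpar y]
  · change ∀ y, _ → stateGraph D.stateA _ = stateGraph D.stateA y
    exact fun y _ => hpar _ _

theorem isEmpty_of_isProper (hD : D.IsConnected) (h : D.presimplicialSet.IsProper) :
    IsEmpty (AugObj (stateGraph D.stateA) 0) := by
  obtain ⟨k, i, a, ha⟩ := h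
  refine ⟨fun e => ha ?_⟩
  exact (congrArg Part.Dom (AugObj.graphPresimplicialSet_d k i a)).mpr (face_dom hD e i a)

/-- Conversely, if all faces are defined, then all edges join the same pair of vertices. -/
theorem nonempty_of_not_isProper (hD : D.IsConnected) (hA : D.IsAAdequate)
    (h : ¬ D.presimplicialSet.IsProper) : Nonempty (AugObj (stateGraph D.stateA) 0) := by
  rcases Nat.eq_zero_or_pos D.numCrossings with h0 | h0
  · have : IsEmpty D.Component := ⟨Quot.ind fun h => (Fin.cast h0 h.1).elim0⟩
    have h1 : D.numLoops = 1 := by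
      rw [IsConnected, Nat.card_of_isEmpty] at hD
      omega
    exact ⟨Sum.inl ⟨loopCircle _ ⟨0, by omega⟩, h0.symm⟩⟩
  · refine ⟨Sum.inr ⟨(Fin.castLEOrderEmb (Nat.zero_le _)), h0, fun x y _ _ => ?_⟩⟩
    by_cases h1 : D.numCrossings = 1
    · have : x = y := by
        have := x.2
        have := y.2
        exact Fin.ext (by omega)
      rw [this]
    · obtain ⟨k, hk⟩ : ∃ k, k + 2 = D.numCrossings := ⟨D.numCrossings - 2, by omega⟩
      -- all faces of the vertices are defined, so every edge is adjacent to every vertex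
      have hmem : ∀ T z, T ∈ stateGraph D.stateA z := by
        intro T z
        by_contra hT
        refine h ⟨k, Fin.cast hk.symm z, (Sum.inl ⟨T, hk⟩ : AugObj (stateGraph D.stateA) (k + 2)),
          fun hd => hT ?_⟩
        have hd' : (AugObj.face (Fin.cast hk.symm z)
          (Sum.inl ⟨T, hk⟩ : AugObj (stateGraph D.stateA) (k + 2))).Dom := hd
        exact hd'
      exact ((Sym2.mem_and_mem_iff (circleOf_ne hA x)).mp ⟨hmem _ y, hmem _ y⟩).symm

theorem subsingleton_augObj_zero (hD : D.IsConnected) :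
    Subsingleton (AugObj (stateGraph D.stateA) 0) := by
  refine ⟨?_⟩
  rintro (⟨T, h⟩ | ⟨w, h⟩) (⟨T', h'⟩ | ⟨w', h'⟩)
  · have : IsEmpty D.Component := ⟨Quot.ind fun x => (Fin.cast h.symm x.1).elim0⟩
    have h1 : D.numLoops = 1 := by
      rw [IsConnected, Nat.card_of_isEmpty] at hD
      omega
    have hT : ∀ T : Circle D.stateA, T = loopCircle _ ⟨0, by omega⟩ := by
      rintro (q | k)
      · obtain ⟨y, rfl⟩ := Quot.exists_rep q
        exact (Fin.cast h.symm y.1).elim0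
      · exact congrArg Sum.inr (Fin.ext (by have := k.2; omega))
    have : T = T' := (hT T).trans (hT T').symm
    subst this
    rfl
  · exact absurd h h'.1.ne
  · exact absurd h' h.1.ne
  · have : w = w' := by
      ext j
      exact j.elim0
    subst this
    rfl

end LinkDiagram

/-! ### Collapsing the base vertex in the augmented cellular complex -/

namespace PartialPresimplicialSet

variable (X : PartialPresimplicialSet)

/-- The base vertex as a cell. -/
def baseCell {X : PartialPresimplicialSet} (b : X.Base) : X.Cell 0 := Sum.inl b

/-- The other vertices as cells. -/
def vertexCell {X : PartialPresimplicialSet} (a : X.obj 0) : X.Cell 0 := Sum.inr a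

theorem eq_baseCell_or_eq_vertexCell {X : PartialPresimplicialSet} (e : X.Cell 0) :
    (∃ b, e = baseCell b) ∨ ∃ a, e = vertexCell a := by
  rcases e with b | a
  exacts [Or.inl ⟨b, rfl⟩, Or.inr ⟨a, rfl⟩]

/-- The chain `a` for a vertex `a`, and `0` for the base vertex. -/
noncomputable def vertexChain {X : PartialPresimplicialSet} : X.Cell 0 → X.obj 0 →₀ ℤ
  | Sum.inl _ => 0
  | Sum.inr a => Finsupp.single a 1

open Classical in
/-- The base vertex as a cellular chain; `0` if `X` is not proper. -/
noncomputable def baseChain : X.Cell 0 →₀ ℤ :=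
  if h : X.IsProper then Finsupp.single (baseCell ⟨(), h⟩) 1 else 0

open Classical in
/-- The alternating sum of the faces that are defined. -/
noncomputable def simplicialD (k : ℕ) : (X.obj (k + 1) →₀ ℤ) →ₗ[ℤ] (X.obj k →₀ ℤ) :=
  Finsupp.linearCombination ℤ fun a => ∑ i : Fin (k + 2), (-1 : ℤ) ^ (i : ℕ) •
    if h : (X.d k i a).Dom then Finsupp.single ((X.d k i a).get h) 1 else 0

/-- The projection of the cellular chains that forgets the base vertex. -/
noncomputable def dropBase : (k : ℕ) → (X.Cell k →₀ ℤ) →ₗ[ℤ] (X.obj k →₀ ℤ)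
  | 0 => Finsupp.linearCombination ℤ vertexChain
  | k + 1 => (LinearMap.id : (X.obj (k + 1) →₀ ℤ) →ₗ[ℤ] (X.obj (k + 1) →₀ ℤ))

/-- The section of `dropBase` that sends a vertex `a` to `a - b`. -/
noncomputable def subBase : (k : ℕ) → (X.obj k →₀ ℤ) →ₗ[ℤ] (X.Cell k →₀ ℤ)
  | 0 => Finsupp.linearCombination ℤ fun a => Finsupp.single (vertexCell a) 1 - X.baseChain
  | k + 1 => (LinearMap.id : (X.obj (k + 1) →₀ ℤ) →ₗ[ℤ] (X.obj (k + 1) →₀ ℤ))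

variable {X}

theorem dropBase_baseCell (b : X.Base) :
    X.dropBase 0 (Finsupp.single (baseCell b) 1) = 0 := by
  rw [dropBase, Finsupp.linearCombination_single, one_smul]
  rfl

theorem dropBase_vertexCell (a : X.obj 0) :
    X.dropBase 0 (Finsupp.single (vertexCell a) 1) = Finsupp.single a 1 := by
  rw [dropBase, Finsupp.linearCombination_single, one_smul]
  rfl

theorem subBase_single (a : X.obj 0) :
    X.subBase 0 (Finsupp.single a 1) = Finsupp.single (vertexCell a) 1 - X.baseChain := by
  rw [subBase, Finsupp.linearCombination_single, one_smul]

theorem baseChain_eq (b : X.Base) : X.baseChain = Finsupp.single (baseCell b) 1 := dif_pos b.2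

theorem baseChain_eq_zero (h : ¬ X.IsProper) : X.baseChain = 0 := dif_neg h

theorem dropBase_baseChain : X.dropBase 0 X.baseChain = 0 := by
  by_cases h : X.IsProper
  · rw [baseChain_eq ⟨(), h⟩, dropBase_baseCell]
  · rw [baseChain_eq_zero h, map_zero]

theorem augmentation_single (e : X.Cell 0) : X.augmentation (Finsupp.single e 1) = 1 := by
  rw [augmentation, Finsupp.linearCombination_single, one_smul]

theorem dropBase_subBase (k : ℕ) (x : X.obj k →₀ ℤ) : X.dropBase k (X.subBase k x) = x := by
  cases k with
  | zero =>
    suffices h : X.dropBase 0 ∘ₗ X.subBase 0 = LinearMap.id from LinearMap.congr_fun h x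
    refine Finsupp.lhom_ext' fun a => LinearMap.ext_ring ?_
    change X.dropBase 0 (X.subBase 0 (Finsupp.single a 1)) = Finsupp.single a 1
    rw [subBase_single, map_sub, dropBase_vertexCell, dropBase_baseChain, sub_zero]
  | succ k => rfl

theorem subBase_dropBase_zero (y : X.Cell 0 →₀ ℤ) :
    X.subBase 0 (X.dropBase 0 y) = y - X.augmentation y • X.baseChain := by
  suffices h : X.subBase 0 ∘ₗ X.dropBase 0 =
      LinearMap.id - X.augmentation.smulRight X.baseChain from LinearMap.congr_fun h y
  refine Finsupp.lhom_ext' fun e => LinearMap.ext_ring ?_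
  change X.subBase 0 (X.dropBase 0 (Finsupp.single e 1)) =
    Finsupp.single e 1 - X.augmentation (Finsupp.single e 1) • X.baseChain
  rw [augmentation_single, one_smul]
  obtain ⟨b, rfl⟩ | ⟨a, rfl⟩ := eq_baseCell_or_eq_vertexCell e
  · rw [dropBase_baseCell, map_zero, baseChain_eq b, sub_self]
  · rw [dropBase_vertexCell, subBase_single]

theorem dropBase_cellChain_simplexMap {k : ℕ} (a : X.obj k) :
    X.dropBase k (cellChain (simplexMap a)) = Finsupp.single a 1 := by
  cases k with
  | zero =>
    refine (congrArg (X.dropBase 0) (cellChain_charMap (X := X) (n := 0) (vertexCell a))).trans ?_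
    exact dropBase_vertexCell a
  | succ k => exact cellChain_charMap (X := X) (n := k + 1) a

theorem dropBase_cellChain_baseMap (k : ℕ) (b : X.Base) :
    X.dropBase k (cellChain (baseMap k b)) = 0 := by
  cases k with
  | zero =>
    refine (congrArg (X.dropBase 0) (cellChain_charMap (X := X) (n := 0) (baseCell b))).trans ?_
    exact dropBase_baseCell b
  | succ k => rw [cellChain_baseMap_succ, map_zero]

theorem simplicialD_single {k : ℕ} (a : X.obj (k + 1)) : X.simplicialD k (Finsupp.single a 1) =
    ∑ i : Fin (k + 2), (-1 : ℤ) ^ (i : ℕ) • X.dropBase k (cellChain ((simplexMap a).comp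
      (coface i))) := by
  rw [simplicialD, Finsupp.linearCombination_single, one_smul]
  refine Finset.sum_congr rfl fun i _ => ?_
  by_cases h : (X.d k i a).Dom
  · rw [dif_pos h, simplexMap_comp_coface_of_dom a i h, dropBase_cellChain_simplexMap]
  · rw [dif_neg h, simplexMap_comp_coface_of_not_dom a i h, dropBase_cellChain_baseMap]

theorem dropBase_cellularD (k : ℕ) (y : X.Cell (k + 1) →₀ ℤ) :
    X.dropBase k (X.cellularD k y) = X.simplicialD k (X.dropBase (k + 1) y) := by
  suffices h : X.dropBase k ∘ₗ X.cellularD k = X.simplicialD k ∘ₗ X.dropBase (k + 1) from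
    LinearMap.congr_fun h y
  refine Finsupp.lhom_ext' fun e => LinearMap.ext_ring ?_
  change X.dropBase k (X.cellularD k (Finsupp.single e 1)) = _
  rw [cellularD_single, map_sum]
  refine Eq.trans ?_ (simplicialD_single (X := X) e).symm
  exact Finset.sum_congr rfl fun i _ => map_smul _ _ _

theorem augmentation_cellularD_apply (y : X.Cell 1 →₀ ℤ) :
    X.augmentation (X.cellularD 0 y) = 0 :=
  LinearMap.congr_fun augmentation_cellularD y

theorem cellularD_subBase (k : ℕ) (x : X.obj (k + 1) →₀ ℤ) :
    X.cellularD k (X.subBase (k + 1) x) = X.subBase k (X.simplicialD k x) := by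
  have h : X.dropBase k (X.cellularD k (X.subBase (k + 1) x)) = X.simplicialD k x := by
    rw [dropBase_cellularD, dropBase_subBase]
  rw [← h]
  cases k with
  | zero => rw [subBase_dropBase_zero, augmentation_cellularD_apply, zero_smul, sub_zero]
  | succ k => rfl

theorem simplicialD_simplicialD (k : ℕ) (x : X.obj (k + 2) →₀ ℤ) :
    X.simplicialD k (X.simplicialD (k + 1) x) = 0 := by
  have h : X.cellularD k (X.cellularD (k + 1) (X.subBase (k + 2) x)) = 0 :=
    LinearMap.congr_fun (cellularD_comp (X := X) k) _
  rw [← dropBase_subBase (k + 2) x, ← dropBase_cellularD, ← dropBase_cellularD, h, map_zero]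

theorem augmentation_subBase_single (a : X.obj 0) :
    X.augmentation (X.subBase 0 (Finsupp.single a 1)) = 1 - X.augmentation X.baseChain := by
  rw [subBase_single, map_sub, augmentation_single]

open Classical in
/-- A sequence of modules, with maps lowering the degree by one, that has the simplices of `X` as
bases in positive degrees, with the alternating sum of the defined faces as the boundary map. In
degree zero it is generated by `ω`, the boundary of each vertex; `ω` vanishes if `X` is proper, and
is a basis otherwise. -/
structure IsModel (X : PartialPresimplicialSet) {M : ℕ → Type} [∀ m, AddCommGroup (M m)]
    [∀ m, Module ℤ (M m)] (d : ∀ m, M (m + 1) →ₗ[ℤ] M m)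
    (b : ∀ k, Module.Basis (X.obj k) ℤ (M (k + 1))) (ω : M 0) (ρ : M 0 →ₗ[ℤ] ℤ) : Prop where
  d_basis : ∀ k a, d (k + 1) (b (k + 1) a) = ∑ i : Fin (k + 2), (-1 : ℤ) ^ (i : ℕ) •
    if h : (X.d k i a).Dom then b k ((X.d k i a).get h) else 0
  d_zero : ∀ a, d 0 (b 0 a) = ω
  smul_eq : ∀ x, ρ x • ω = x
  augmentation_eq : X.augmentation X.baseChain = 1 - ρ ω

namespace IsModel

variable {M : ℕ → Type} [∀ m, AddCommGroup (M m)] [∀ m, Module ℤ (M m)]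
  {d : ∀ m, M (m + 1) →ₗ[ℤ] M m} {b : ∀ k, Module.Basis (X.obj k) ℤ (M (k + 1))} {ω : M 0}
  {ρ : M 0 →ₗ[ℤ] ℤ}

theorem repr_d (h : IsModel X d b ω ρ) (k : ℕ) (x : M (k + 2)) :
    (b k).repr (d (k + 1) x) = X.simplicialD k ((b (k + 1)).repr x) := by
  suffices e : (b k).repr.toLinearMap ∘ₗ d (k + 1) =
      X.simplicialD k ∘ₗ (b (k + 1)).repr.toLinearMap from LinearMap.congr_fun e x
  refine (b (k + 1)).ext fun a => ?_
  simp only [LinearMap.comp_apply, LinearEquiv.coe_coe, h.d_basis, Module.Basis.repr_self, map_sum,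
    map_zsmul, simplicialD, Finsupp.linearCombination_single, one_smul]
  refine Finset.sum_congr rfl fun i _ => congrArg _ ?_
  split_ifs
  · rw [Module.Basis.repr_self]
  · rw [map_zero]

theorem augmentation_subBase (h : IsModel X d b ω ρ) (x : M 1) :
    X.augmentation (X.subBase 0 ((b 0).repr x)) = ρ (d 0 x) := by
  suffices e : X.augmentation ∘ₗ X.subBase 0 ∘ₗ (b 0).repr.toLinearMap = ρ ∘ₗ d 0 from
    LinearMap.congr_fun e x
  refine (b 0).ext fun a => ?_
  simp only [LinearMap.comp_apply, LinearEquiv.coe_coe, Module.Basis.repr_self, h.d_zero,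
    augmentation_subBase_single, h.augmentation_eq, sub_sub_cancel]

theorem d_symm_dropBase (h : IsModel X d b ω ρ) (y : X.Cell 0 →₀ ℤ) :
    d 0 ((b 0).repr.symm (X.dropBase 0 y)) = X.augmentation y • ω := by
  rw [← h.smul_eq (d 0 _), ← h.augmentation_subBase, LinearEquiv.apply_symm_apply,
    subBase_dropBase_zero, map_sub, map_smul, h.augmentation_eq, smul_eq_mul, mul_sub, mul_one,
    sub_sub_cancel, mul_smul, h.smul_eq]

theorem d_comp_d (h : IsModel X d b ω ρ) (m : ℕ) : d m ∘ₗ d (m + 1) = 0 := by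
  refine LinearMap.ext fun x => ?_
  rw [LinearMap.comp_apply, LinearMap.zero_apply]
  cases m with
  | zero =>
    rw [← h.smul_eq (d 0 _), ← h.augmentation_subBase, h.repr_d, ← cellularD_subBase,
      augmentation_cellularD_apply, zero_smul]
  | succ k =>
    refine (b k).repr.injective ?_
    rw [h.repr_d, h.repr_d, simplicialD_simplicialD, map_zero]

end IsModel

theorem reducedCellularComplex_d_apply (k : ℕ) (y : X.Cell (k + 1) →₀ ℤ) :
    (X.reducedCellularComplex.d (k + 2) (k + 1)).hom y = X.cellularD k y :=
  congrArg (fun f : (X.cellularComplex.X (k + 1) ⟶ X.cellularComplex.X k) => f.hom y)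
    ((ChainComplex.augment_d_succ_succ _ _ _ _ _).trans (X.cellularComplex_d k))

section HomotopyEquiv

variable {K : ChainComplex (ModuleCat.{0} ℤ) ℕ}
  {b : ∀ k, Module.Basis (X.obj k) ℤ (K.X (k + 1))} {ω : K.X 0} {ρ : K.X 0 →ₗ[ℤ] ℤ}

/-- The chain map from a model to the reduced cellular complex. -/
noncomputable def fromModel
    (h : IsModel X (M := fun m => K.X m) (fun m => (K.d (m + 1) m).hom) b ω ρ) :
    K ⟶ X.reducedCellularComplex where
  f
    | 0 => ModuleCat.ofHom ρ
    | k + 1 => ModuleCat.ofHom (X.subBase k ∘ₗ (b k).repr.toLinearMap)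
  comm' := by
    rintro _ (_ | k) rfl
    · refine ModuleCat.hom_ext (LinearMap.ext fun x => ?_)
      exact h.augmentation_subBase x
    · refine ModuleCat.hom_ext (LinearMap.ext fun x => ?_)
      refine (reducedCellularComplex_d_apply k (X.subBase (k + 1) ((b (k + 1)).repr x))).trans ?_
      exact (cellularD_subBase k _).trans (congrArg (X.subBase k) (h.repr_d k x).symm)

/-- The chain map from the reduced cellular complex to a model that forgets the base vertex. -/
noncomputable def toModel
    (h : IsModel X (M := fun m => K.X m) (fun m => (K.d (m + 1) m).hom) b ω ρ) :
    X.reducedCellularComplex ⟶ K where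
  f
    | 0 => ModuleCat.ofHom (LinearMap.toSpanSingleton ℤ (K.X 0) ω)
    | k + 1 => ModuleCat.ofHom ((b k).repr.symm.toLinearMap ∘ₗ X.dropBase k)
  comm' := by
    rintro _ (_ | k) rfl
    · refine ModuleCat.hom_ext (LinearMap.ext fun y => ?_)
      exact (h.d_symm_dropBase y).trans (int_smul_eq_zsmul _ _ _).symm
    · refine ModuleCat.hom_ext (LinearMap.ext fun y => (b k).repr.injective ?_)
      have e : (b k).repr ((b k).repr.symm (X.dropBase k
          ((X.reducedCellularComplex.d (k + 2) (k + 1)).hom y))) =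
          X.dropBase k (X.cellularD k y) := by
        rw [LinearEquiv.apply_symm_apply]
        exact congrArg (X.dropBase k) (reducedCellularComplex_d_apply k y)
      refine Eq.trans ?_ e.symm
      refine (h.repr_d k _).trans ?_
      change X.simplicialD k ((b (k + 1)).repr ((b (k + 1)).repr.symm (X.dropBase (k + 1) y))) = _
      rw [LinearEquiv.apply_symm_apply]
      exact (dropBase_cellularD k y).symm

/-- The homotopy that sends the generator in dimension `-1` to `-b`. -/
noncomputable def baseHomotopy (X : PartialPresimplicialSet) :
    ∀ i j, X.reducedCellularComplex.X i ⟶ X.reducedCellularComplex.X j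
  | 0, 1 => ModuleCat.ofHom (LinearMap.toSpanSingleton ℤ (X.Cell 0 →₀ ℤ) (-X.baseChain))
  | _, _ => 0

theorem baseHomotopy_succ (i j : ℕ) : X.baseHomotopy (i + 1) j = 0 := rfl

/-- A model of `X` is homotopy equivalent to the reduced cellular complex: where the base vertex is
present, it cancels against the generator in dimension `-1`. -/
noncomputable def homotopyEquiv
    (h : IsModel X (M := fun m => K.X m) (fun m => (K.d (m + 1) m).hom) b ω ρ) :
    HomotopyEquiv K X.reducedCellularComplex where
  hom := fromModel h
  inv := toModel h
  homotopyHomInvId := Homotopy.ofEq (by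
    refine HomologicalComplex.hom_ext _ _ fun m => ?_
    rcases m with _ | k
    · refine ModuleCat.hom_ext (LinearMap.ext fun x => ?_)
      exact (int_smul_eq_zsmul _ _ _).trans (h.smul_eq x)
    · refine ModuleCat.hom_ext (LinearMap.ext fun x => ?_)
      change (b k).repr.symm (X.dropBase k (X.subBase k ((b k).repr x))) = x
      rw [dropBase_subBase, LinearEquiv.symm_apply_apply])
  homotopyInvHomId :=
    { hom := X.baseHomotopy
      zero := fun i j hij => by
        match i, j with
        | 0, 1 => exact absurd rfl hij
        | 0, 0 => rfl
        | 0, _ + 2 => rfl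
        | _ + 1, _ => rfl
      comm := fun m => by
        rw [Homotopy.prevD_chainComplex]
        rcases m with _ | _ | k
        · rw [Homotopy.dNext_zero_chainComplex, zero_add]
          refine ModuleCat.hom_ext (LinearMap.ext_ring ?_)
          change ρ (LinearMap.toSpanSingleton ℤ (K.X 0) ω 1) =
            X.augmentation (LinearMap.toSpanSingleton ℤ (X.Cell 0 →₀ ℤ) (-X.baseChain) 1) + 1
          rw [LinearMap.toSpanSingleton_apply_one, LinearMap.toSpanSingleton_apply_one, map_neg,
            h.augmentation_eq]
          ring
        · rw [Homotopy.dNext_succ_chainComplex, baseHomotopy_succ, Limits.zero_comp, add_zero]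
          refine ModuleCat.hom_ext (LinearMap.ext fun (y : X.Cell 0 →₀ ℤ) => ?_)
          change X.subBase 0 ((b 0).repr ((b 0).repr.symm (X.dropBase 0 y))) =
            LinearMap.toSpanSingleton ℤ (X.Cell 0 →₀ ℤ) (-X.baseChain) (X.augmentation y) + y
          rw [LinearEquiv.apply_symm_apply, subBase_dropBase_zero,
            LinearMap.toSpanSingleton_apply, smul_neg]
          abel
        · rw [Homotopy.dNext_succ_chainComplex, baseHomotopy_succ, baseHomotopy_succ,
            Limits.zero_comp, Limits.comp_zero, add_zero, zero_add]
          refine ModuleCat.hom_ext (LinearMap.ext fun y => ?_)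
          change X.subBase (k + 1) ((b (k + 1)).repr ((b (k + 1)).repr.symm
            (X.dropBase (k + 1) y))) = y
          rw [LinearEquiv.apply_symm_apply]
          rfl }

end HomotopyEquiv

end PartialPresimplicialSet

/-! ### The almost-extreme complex -/

namespace LinkDiagram

variable {D : LinkDiagram}

open Classical in
theorem khovanovD_generatorBasis_succ (hA : D.IsAAdequate) (k : ℕ)
    (a : D.presimplicialSet.obj (k + 1)) :
    D.khovanovD (2 * (k + 2 : ℕ) - D.numCrossings) (2 * (k + 1 : ℕ) - D.numCrossings) D.jAlmax
        (generatorBasis hA (k + 2) a) =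
      ∑ i : Fin (k + 2), (-1 : ℤ) ^ (i : ℕ) • if h : (D.presimplicialSet.d k i a).Dom then
        generatorBasis hA (k + 1) ((D.presimplicialSet.d k i a).get h) else 0 := by
  have h : ∀ p q : Part (AugObj (stateGraph D.stateA) (k + 1)), p = q →
      (if h : p.Dom then generatorBasis hA (k + 1) (p.get h) else 0) =
        if h : q.Dom then generatorBasis hA (k + 1) (q.get h) else 0 := by
    rintro p _ rfl
    rfl
  refine (khovanovD_generatorBasis hA (m := k + 1) a).trans
    (Finset.sum_congr rfl fun i _ => congrArg _ ?_)
  exact h _ _ (AugObj.graphPresimplicialSet_d k i a).symm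

/-- The almost-extreme chain groups and their differentials, with the bases of the simplices, form a
model of the partial presimplicial set. -/
theorem exists_isModel (hD : D.IsConnected) (hA : D.IsAAdequate) :
    ∃ ω ρ, D.presimplicialSet.IsModel
      (M := fun m => D.Generator (2 * m - D.numCrossings) D.jAlmax →₀ ℤ)
      (fun m => D.khovanovD (2 * (m + 1 : ℕ) - D.numCrossings) (2 * m - D.numCrossings) D.jAlmax)
      (fun k => generatorBasis hA (k + 1)) ω ρ := by
  classical
  by_cases hp : D.presimplicialSet.IsProper
  · have := isEmpty_of_isProper hD hp
    have : Subsingleton (D.Generator (2 * (0 : ℕ) - D.numCrossings) D.jAlmax →₀ ℤ) :=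
      (generatorBasis hA 0).repr.injective.subsingleton
    refine ⟨0, 0, khovanovD_generatorBasis_succ hA, fun a => Subsingleton.elim _ _,
      fun x => Subsingleton.elim _ _, ?_⟩
    rw [PartialPresimplicialSet.baseChain_eq ⟨(), hp⟩,
      PartialPresimplicialSet.augmentation_single, map_zero, sub_zero]
  · obtain ⟨e⟩ := nonempty_of_not_isProper hD hA hp
    have := subsingleton_augObj_zero hD
    let b := generatorBasis hA 0
    refine ⟨b e, b.coord e, khovanovD_generatorBasis_succ hA, fun a => ?_, fun x => ?_, ?_⟩
    · have hdom := face_dom hD e 0 a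
      refine (khovanovD_generatorBasis hA (m := 0) a).trans ((Fin.sum_univ_one _).trans ?_)
      refine (congrArg _ (dif_pos hdom)).trans ?_
      rw [Fin.val_zero, pow_zero, one_smul]
      exact congrArg b (Subsingleton.elim _ _)
    · have := Fintype.ofSubsingleton e
      have h := b.sum_repr x
      rw [Fintype.sum_subsingleton _ e] at h
      exact h
    · rw [PartialPresimplicialSet.baseChain_eq_zero hp, map_zero, Module.Basis.coord_apply,
        Module.Basis.repr_self, Finsupp.single_eq_same, sub_self]

theorem khovanovSquareZero (hD : D.IsConnected) (hA : D.IsAAdequate) :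
    D.KhovanovSquareZero D.jAlmax := by
  obtain ⟨ω, ρ, hM⟩ := exists_isModel hD hA
  intro i
  refine Finsupp.lhom_ext' fun S => LinearMap.ext_ring ?_
  have hS := S.2.1
  rw [iDeg_eq] at hS
  have hc : (labelB S.1.1).card ≤ D.numCrossings := by
    simpa using Finset.card_le_univ (labelB S.1.1)
  by_cases h2 : (labelB S.1.1).card + 2 ≤ D.numCrossings
  · -- here `i = 2 m - c` with `m ≥ 2`
    have key : ∀ (k : ℕ) (i i' i'' : ℤ), i = 2 * (k + 1 + 1 : ℕ) - D.numCrossings →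
        i' = 2 * (k + 1 : ℕ) - D.numCrossings → i'' = 2 * k - D.numCrossings →
        D.khovanovD i' i'' D.jAlmax ∘ₗ D.khovanovD i i' D.jAlmax = 0 := by
      rintro k i i' i'' rfl rfl rfl
      exact hM.d_comp_d k
    obtain ⟨k, hk⟩ := Nat.exists_eq_add_of_le h2
    rw [key k _ _ _ (by omega) (by omega) (by omega)]
  · -- there is no state with two `A`-labels less
    have : IsEmpty (D.Generator (i - 2 - 2) D.jAlmax) := ⟨fun T => by
      have hT := T.2.1
      rw [iDeg_eq] at hT
      have : (labelB T.1.1).card ≤ D.numCrossings := by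
        simpa using Finset.card_le_univ (labelB T.1.1)
      omega⟩
    exact Subsingleton.elim _ _

end LinkDiagram

/-- For a connected `A`-adequate link diagram `D`, the almost-extreme Khovanov complex of `D` is a
chain complex, and it is chain homotopy equivalent to the reduced cellular chain complex of the
geometric realization of the partial presimplicial set `X_D` (the chains of dimension `m - 1`
corresponding to the Khovanov degree `i = 2m - c`). -/
theorem mainTheorem3 (D : LinkDiagram) (hconn : D.IsConnected) (hA : D.IsAAdequate) :
    ∃ h : D.KhovanovSquareZero D.jAlmax,
      Nonempty (HomotopyEquiv (D.khovanovComplex D.jAlmax h)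
        D.presimplicialSet.reducedCellularComplex) := by
  obtain ⟨ω, ρ, hM⟩ := LinkDiagram.exists_isModel hconn hA
  have h := LinkDiagram.khovanovSquareZero hconn hA
  exact ⟨h, ⟨PartialPresimplicialSet.homotopyEquiv (K := D.khovanovComplex D.jAlmax h)
    (b := fun k => LinkDiagram.generatorBasis hA (k + 1)) hM⟩⟩
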